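/- **Proposition (absolute convergence of $\mathcal Z(W_1,W_2,f;\mu_v,|\cdot|_v^{s_1},|\cdot|_v^{s_2})$).** Let $F_v$ be a local field of characteristic zero, with normalized absolute value $|\cdot|_v$ (the module of $F_v$), let $\psi=\mathbf e$ be a non-trivial continuous unitary additive character of $F_v$, and let $K_v\subset \mathrm{GL}_2(F_v)$ be the standard maximal compact subgroup ($\mathrm{GL}_2(\mathcal O_v)$, $\mathrm O(2)$ or $\mathrm U(2)$). Let $\pi_1,\pi_2$ be irreducible admissible representations of $\mathrm{GL}_2(F_v)$ with central characters satisfying $\omega_{\pi_1}\omega_{\pi_2}=1$ (smooth representations if $v$ is non-archimedean, Banach space representations if $v$ is archimedean). For $i=1,2$ let $W_i(g)=\lambda_i(\pi_i(g)w_i)$ be a Whittaker function of $\pi_i$ with respect to $\psi$: $w_i$ is a vector of $\pi_i$ (a smooth vector if $v$ is archimedean) and $\lambda_i$ is a linear functional on the space of smooth vectors (continuous for its Fréchet topology if $v$ is archimedean) with $$\lambda_i\bigl(\pi_i\begin{pmatrix}1&x\\&1\end{pmatrix}w\bigr)=\psi(x)\lambda_i(w)\qquad\text{for all } x\in F_v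 \text{ and all smooth vectors } w.$$ Let $\mu_v$ be a quasi-character of $F_v^\times$ (a continuous homomorphism $F_v^\times\to\mathbb C^\times$). For a Schwartz–Bruhat function $f$ on $\mathsf M_2(F_v)\times \mathsf M_2(F_v)$ and $s_1,s_2\in\mathbb C$ put $$\begin{aligned} \mathcal Z(W_1,W_2,f;\mu_v,|\cdot|_v^{s_1},|\cdot|_v^{s_2}) =&\int_{u,v\in F_v}\int_{\epsilon\in F_v^\times}\int_{K_v^2} f\Bigl(k_1^{-1}\begin{pmatrix}\epsilon^{-1}&\epsilon^{-1}v\\0&0\end{pmatrix}k_2,\;k_1^{-1}\begin{pmatrix}0&-u\epsilon\\0&\epsilon\end{pmatrix}k_2\Bigr)\,\omega_{\pi_2}(\epsilon)|\epsilon|_v^{2s_2-2}\\ &\times\Bigl(\int_{F_v^\times}W_1\bigl(\begin{pmatrix}\alpha\\&1\end{pmatrix}k_1\bigr)\mathbf e(u\alpha)\mu_v(\alpha)|\alpha|_v^{s_1-\frac12}\,d^\times\alpha\Bigr)\\ &\times\Bigl(\int_{F_v^\times}W_2\bigl(\begin{pmatrix}\beta\\&1\end{pmatrix}k_2\bigr)\mathbf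 e(v\beta)\mu_v^{-1}(\beta)|\beta|_v^{s_2-\frac12}\,d^\times\beta\Bigr)\,du\,dv\,d^\times\epsilon\,dk_1\,dk_2, \end{aligned}$$ where all measures are Haar measures. Then there is a real number $c$, depending on $W_1,W_2,\mu_v$ (and $\pi_1,\pi_2,\psi$) but not on $f$, $s_1$, $s_2$, such that for every Schwartz–Bruhat function $f$ and all $s_1,s_2\in\mathbb C$ with $\mathrm{Re}\,s_1>c$ and $\mathrm{Re}\,s_2>c$ the integral converges absolutely. That is: the integral over $\alpha$ converges absolutely for all $k_1\in K_v$, $u\in F_v$; the integral over $\beta$ converges absolutely for all $k_2\in K_v$, $v\in F_v$; the outer integral over $(u,v,\epsilon,k_1,k_2)$ converges absolutely; and the integrand in all the variables $(u,v,\epsilon,k_1,k_2,\alpha,\beta)$ together is absolutely integrable. -/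

import Mathlib

open MeasureTheory Matrix
open scoped SchwartzMap

noncomputable section

namespace ZetaTwo

/-! ### Group elements, quasi-characters, absolute value -/

section Local

variable {F : Type*} [Field F]

/-- The matrix `diag(a, 1)`. -/
def diagOne (a : Fˣ) : GL (Fin 2) F where
  val := !![(a : F), 0; 0, 1]
  inv := !![((a⁻¹ : Fˣ) : F), 0; 0, 1]
  val_inv := by simp [Matrix.one_fin_two]
  inv_val := by simp [Matrix.one_fin_two]

/-- The unipotent matrix `[1, x; 0, 1]`. -/
def unip (x : F) : GL (Fin 2) F := GeneralLinearGroup.upperRightHom x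

variable [TopologicalSpace F] [IsTopologicalRing F]

/-- The normalized absolute value `|a|_v`: the factor by which multiplication by `a` scales
additive Haar measure on `F`. -/
def normAbs [LocallyCompactSpace F] [MeasurableSpace F] [BorelSpace F] (a : Fˣ) : ℝ :=
  (distribHaarChar F a : ℝ)

/-- The quasi-character `a ↦ |a|_v ^ s`. -/
def absPow [LocallyCompactSpace F] [MeasurableSpace F] [BorelSpace F] (a : Fˣ) (s : ℂ) : ℂ :=
  (normAbs a : ℂ) ^ s

/-! ### Abstract Whittaker functions -/

/-- `ω` is the central character of `π`. -/
def IsCentralCharacter {V : Type*} [AddCommGroup V] [Module ℂ V]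
    (π : GL (Fin 2) F →* (V →ₗ[ℂ] V)) (ω : Fˣ →ₜ* ℂˣ) : Prop :=
  ∀ (z : Fˣ) (v : V), π (GeneralLinearGroup.scalar (Fin 2) z) v = ((ω z : ℂˣ) : ℂ) • v

/-- `ℓ (π (n(x)) v) = ψ(x) ℓ(v)` for all `x` and `v`. -/
def IsWhittakerFunctional {V : Type*} [AddCommGroup V] [Module ℂ V]
    (π : GL (Fin 2) F →* (V →ₗ[ℂ] V)) (ψ : AddChar F Circle) (ℓ : V →ₗ[ℂ] ℂ) : Prop :=
  ∀ (x : F) (v : V), ℓ (π (unip x) v) = (ψ x : ℂ) * ℓ v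

/-! ### The local zeta integral in two complex variables -/

variable [LocallyCompactSpace F] [MeasurableSpace F] [BorelSpace F]

/-- The integrand `W(diag(α,1) k) ψ(uα) χ(α) |α|^{s - 1/2}`. -/
def torusIntegrand (ψ : AddChar F Circle) (W : GL (Fin 2) F → ℂ) (χ : Fˣ →ₜ* ℂˣ) (s : ℂ)
    (k : GL (Fin 2) F) (u : F) (α : Fˣ) : ℂ :=
  W (diagOne α * k) * (ψ (u * α) : ℂ) * ((χ α : ℂˣ) : ℂ) * absPow α (s - 1 / 2)

/-- The weight
`f(k₁⁻¹ [ε⁻¹, ε⁻¹v; 0, 0] k₂, k₁⁻¹ [0, -uε; 0, ε] k₂) ω(ε) |ε|^{2 s₂ - 2}`. -/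
def schwartzWeight (f : Matrix (Fin 2) (Fin 2) F × Matrix (Fin 2) (Fin 2) F → ℂ)
    (ω : Fˣ →ₜ* ℂˣ) (s₂ : ℂ) (u v : F) (ε : Fˣ) (k₁ k₂ : GL (Fin 2) F) : ℂ :=
  f ((k₁⁻¹ : GL (Fin 2) F).val * !![(ε : F)⁻¹, (ε : F)⁻¹ * v; 0, 0] * k₂.val,
     (k₁⁻¹ : GL (Fin 2) F).val * !![0, -u * (ε : F); 0, (ε : F)] * k₂.val)
    * ((ω ε : ℂˣ) : ℂ) * absPow ε (2 * s₂ - 2)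

variable {K : Subgroup (GL (Fin 2) F)}

/-- The integrand of the outer integral over `(u, v, ε, k₁, k₂)`; the two inner integrals over
`Fˣ` are carried out. Here `ω` stands for the central character of the second representation. -/
def outerIntegrand (dt : Measure Fˣ) (ψ : AddChar F Circle) (ω μ : Fˣ →ₜ* ℂˣ)
    (W₁ W₂ : GL (Fin 2) F → ℂ)
    (f : Matrix (Fin 2) (Fin 2) F × Matrix (Fin 2) (Fin 2) F → ℂ) (s₁ s₂ : ℂ)
    (p : F × F × Fˣ × K × K) : ℂ :=
  schwartzWeight f ω s₂ p.1 p.2.1 p.2.2.1 p.2.2.2.1 p.2.2.2.2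
    * (∫ α, torusIntegrand ψ W₁ μ s₁ p.2.2.2.1 p.1 α ∂dt)
    * (∫ β, torusIntegrand ψ W₂ μ⁻¹ s₂ p.2.2.2.2 p.2.1 β ∂dt)

/-- The integrand in all variables `((u, v, ε, k₁, k₂), (α, β))`. -/
def fullIntegrand (ψ : AddChar F Circle) (ω μ : Fˣ →ₜ* ℂˣ)
    (W₁ W₂ : GL (Fin 2) F → ℂ)
    (f : Matrix (Fin 2) (Fin 2) F × Matrix (Fin 2) (Fin 2) F → ℂ) (s₁ s₂ : ℂ)
    (q : (F × F × Fˣ × K × K) × (Fˣ × Fˣ)) : ℂ :=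
  schwartzWeight f ω s₂ q.1.1 q.1.2.1 q.1.2.2.1 q.1.2.2.2.1 q.1.2.2.2.2
    * torusIntegrand ψ W₁ μ s₁ q.1.2.2.2.1 q.1.1 q.2.1
    * torusIntegrand ψ W₂ μ⁻¹ s₂ q.1.2.2.2.2 q.1.2.1 q.2.2

/-- The product measure `du dv d^×ε dk₁ dk₂`. -/
def outerMeasure [MeasurableSpace K] (dx : Measure F) (dt : Measure Fˣ) (dk : Measure K) :
    Measure (F × F × Fˣ × K × K) :=
  dx.prod (dx.prod (dt.prod (dk.prod dk)))

/-- Absolute convergence of the zeta integral `𝒵(W₁, W₂, f; μ, |·|^{s₁}, |·|^{s₂})`: every inner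
integral converges absolutely, the outer integral converges absolutely, and the integral over all
the variables together converges absolutely. -/
structure ZetaConvergesAbsolutely [MeasurableSpace K]
    (dx : Measure F) (dt : Measure Fˣ) (dk : Measure K)
    (ψ : AddChar F Circle) (ω μ : Fˣ →ₜ* ℂˣ) (W₁ W₂ : GL (Fin 2) F → ℂ)
    (f : Matrix (Fin 2) (Fin 2) F × Matrix (Fin 2) (Fin 2) F → ℂ) (s₁ s₂ : ℂ) : Prop where
  inner₁ : ∀ (k : K) (u : F), Integrable (torusIntegrand ψ W₁ μ s₁ k u) dt
  inner₂ : ∀ (k : K) (v : F), Integrable (torusIntegrand ψ W₂ μ⁻¹ s₂ k v) dt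
  outer : Integrable (outerIntegrand dt ψ ω μ W₁ W₂ f s₁ s₂) (outerMeasure dx dt dk)
  full : Integrable (fullIntegrand ψ ω μ W₁ W₂ f s₁ s₂)
    ((outerMeasure dx dt dk).prod (dt.prod dt))

end Local

/-! ### Non-archimedean places -/

section NonArch

variable (F : Type*) [NontriviallyNormedField F] [IsUltrametricDist F]

/-- `GL₂(𝒪)`: the elements `g` such that `g` and `g⁻¹` have entries in the ring of integers. -/
def integralGL : Subgroup (GL (Fin 2) F) where
  carrier := {g | (∀ i j, ‖g.val i j‖ ≤ 1) ∧ ∀ i j, ‖(g⁻¹ : GL (Fin 2) F).val i j‖ ≤ 1}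
  one_mem' := by
    constructor <;> intro i j <;> fin_cases i <;> fin_cases j <;> simp
  mul_mem' := by
    have key : ∀ A B : Matrix (Fin 2) (Fin 2) F, (∀ i j, ‖A i j‖ ≤ 1) → (∀ i j, ‖B i j‖ ≤ 1) →
        ∀ i j, ‖(A * B) i j‖ ≤ 1 := by
      intro A B hA hB i j
      rw [Matrix.mul_apply, Fin.sum_univ_two]
      refine (IsUltrametricDist.norm_add_le_max _ _).trans (max_le ?_ ?_) <;>
      · rw [norm_mul]
        exact mul_le_one₀ (hA _ _) (norm_nonneg _) (hB _ _)
    rintro a b ⟨ha, ha'⟩ ⟨hb, hb'⟩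
    refine ⟨?_, ?_⟩
    · rw [Units.val_mul]; exact key _ _ ha hb
    · rw [_root_.mul_inv_rev, Units.val_mul]; exact key _ _ hb' ha'
  inv_mem' := by
    rintro a ⟨ha, ha'⟩
    exact ⟨ha', by rw [inv_inv]; exact ha⟩

variable {F}

/-- Admissible smooth representation: every vector has an open stabilizer, and the vectors fixed
by an open subgroup form a finite-dimensional space. -/
structure IsAdmissibleNA {V : Type*} [AddCommGroup V] [Module ℂ V]
    (π : Representation ℂ (GL (Fin 2) F) V) : Prop where
  smooth : ∀ v : V, IsOpen {g : GL (Fin 2) F | π g v = v}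
  finite : ∀ U : Subgroup (GL (Fin 2) F), IsOpen (U : Set (GL (Fin 2) F)) →
    FiniteDimensional ℂ (Representation.invariants (π.comp U.subtype))

/-- The Whittaker functions of `π` with respect to `ψ`: the functions `g ↦ ℓ (π(g) v)` with `ℓ` a
Whittaker functional. -/
def whittakerNA {V : Type*} [AddCommGroup V] [Module ℂ V]
    (π : Representation ℂ (GL (Fin 2) F) V) (ψ : AddChar F Circle) :
    Set (GL (Fin 2) F → ℂ) :=
  {W | ∃ ℓ : V →ₗ[ℂ] ℂ, IsWhittakerFunctional π ψ ℓ ∧ ∃ v : V, W = fun g => ℓ (π g v)}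

/-- Schwartz–Bruhat functions: locally constant with compact support. -/
def IsSchwartzBruhatNA (f : Matrix (Fin 2) (Fin 2) F × Matrix (Fin 2) (Fin 2) F → ℂ) : Prop :=
  IsLocallyConstant f ∧ HasCompactSupport f

end NonArch

/-! ### Archimedean places -/

section Arch

variable (𝕜 : Type*) [RCLike 𝕜]

/-- The standard maximal compact subgroup: `O(2)` for `𝕜 = ℝ`, `U(2)` for `𝕜 = ℂ`. -/
def unitaryGL : Subgroup (GL (Fin 2) 𝕜) where
  carrier := {g | (g.val)ᴴ * g.val = 1}
  one_mem' := by simp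
  mul_mem' := by
    intro a b ha hb
    simp only [Set.mem_ofPred_eq, Units.val_mul, Matrix.conjTranspose_mul] at *
    calc (b.val)ᴴ * (a.val)ᴴ * (a.val * b.val)
        = (b.val)ᴴ * ((a.val)ᴴ * a.val) * b.val := by simp only [Matrix.mul_assoc]
      _ = 1 := by rw [ha, Matrix.mul_one, hb]
  inv_mem' := by
    intro a ha
    simp only [Set.mem_ofPred_eq] at *
    have h : (a⁻¹ : GL (Fin 2) 𝕜).val = (a.val)ᴴ := by
      have h2 : (a.val)ᴴ * a.val * (a⁻¹ : GL (Fin 2) 𝕜).val = (a⁻¹ : GL (Fin 2) 𝕜).val := by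
        rw [ha, Matrix.one_mul]
      rw [← h2, Matrix.mul_assoc, Units.mul_inv, Matrix.mul_one]
    rw [h, Matrix.conjTranspose_conjTranspose, ← h, Units.mul_inv]

variable {𝕜}
variable {H : Type*} [NormedAddCommGroup H] [NormedSpace ℂ H]

open Classical in
/-- The orbit map `g ↦ π(g) v` in matrix coordinates, extended by zero to singular matrices. -/
def orbitMap (π : GL (Fin 2) 𝕜 →* (H →L[ℂ] H)) (v : H) (x : Fin 2 → Fin 2 → 𝕜) : H :=
  if h : IsUnit (Matrix.of x) then π h.unit v else 0

/-- The open set of invertible matrices, in matrix coordinates. -/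
def invertibleSet (𝕜 : Type*) [RCLike 𝕜] : Set (Fin 2 → Fin 2 → 𝕜) :=
  {x | IsUnit (Matrix.of x)}

/-- The space `H^∞` of smooth vectors: those with a smooth orbit map. -/
def smoothVectors (π : GL (Fin 2) 𝕜 →* (H →L[ℂ] H)) : Submodule ℂ H where
  carrier := {v | ContDiffOn ℝ ((⊤ : ℕ∞) : WithTop ℕ∞) (orbitMap π v) (invertibleSet 𝕜)}
  zero_mem' := by
    have : orbitMap π (0 : H) = fun _ => 0 := by
      funext x; simp [orbitMap]
    simpa [this] using contDiffOn_const
  add_mem' := by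
    intro a b ha hb
    have : orbitMap π (a + b) = fun x => orbitMap π a x + orbitMap π b x := by
      funext x; by_cases h : IsUnit (Matrix.of x) <;> simp [orbitMap, h]
    simpa [this] using ha.add hb
  smul_mem' := by
    intro c a ha
    have : orbitMap π (c • a) = fun x => c • orbitMap π a x := by
      funext x; by_cases h : IsUnit (Matrix.of x) <;> simp [orbitMap, h]
    simpa [this] using ha.const_smul c

theorem smoothVectors_apply_mem (π : GL (Fin 2) 𝕜 →* (H →L[ℂ] H)) (g : GL (Fin 2) 𝕜)
    {v : H} (hv : v ∈ smoothVectors π) : π g v ∈ smoothVectors π := by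
  have hR : ContDiff ℝ ((⊤ : ℕ∞) : WithTop ℕ∞)
      (fun x : Fin 2 → Fin 2 → 𝕜 => fun i j => ∑ l, x i l * g.val l j) := by
    fun_prop
  have hof : ∀ x : Fin 2 → Fin 2 → 𝕜,
      Matrix.of (fun i j => ∑ l, x i l * g.val l j) = Matrix.of x * g.val := by
    intro x; ext i j; simp [Matrix.mul_apply]
  have hunit : ∀ x : Fin 2 → Fin 2 → 𝕜,
      IsUnit (Matrix.of (fun i j => ∑ l, x i l * g.val l j)) ↔ IsUnit (Matrix.of x) := by
    intro x; rw [hof]; exact Units.isUnit_mul_units _ g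
  have horb : orbitMap π (π g v) = orbitMap π v ∘
      (fun x : Fin 2 → Fin 2 → 𝕜 => fun i j => ∑ l, x i l * g.val l j) := by
    funext x
    by_cases h : IsUnit (Matrix.of x)
    · have h' := (hunit x).2 h
      have hu : h'.unit = h.unit * g := by
        ext1
        rw [Units.val_mul, IsUnit.unit_spec, IsUnit.unit_spec]
        exact hof x
      simp only [orbitMap, Function.comp, dif_pos h, dif_pos h', hu, map_mul]
      rfl
    · have h' : ¬ IsUnit (Matrix.of (fun i j => ∑ l, x i l * g.val l j)) :=
        fun hh => h ((hunit x).1 hh)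
      simp only [orbitMap, Function.comp, dif_neg h, dif_neg h']
  change ContDiffOn ℝ ((⊤ : ℕ∞) : WithTop ℕ∞) (orbitMap π (π g v)) (invertibleSet 𝕜)
  rw [horb]
  exact ContDiffOn.comp hv hR.contDiffOn (fun x hx => (hunit x).2 hx)

/-- The action of `GL₂(𝕜)` on the smooth vectors. -/
def smoothRep (π : GL (Fin 2) 𝕜 →* (H →L[ℂ] H)) :
    Representation ℂ (GL (Fin 2) 𝕜) (smoothVectors π) where
  toFun g := ((π g : H →L[ℂ] H) : H →ₗ[ℂ] H).restrict
    (fun _ hv => smoothVectors_apply_mem π g hv)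
  map_one' := by ext v; simp
  map_mul' a b := by ext v; simp

/-- The seminorms `‖D^j (g ↦ π(g) v) (1)‖` that define the Fréchet topology of `H^∞`. -/
def smoothSeminorm (π : GL (Fin 2) 𝕜 →* (H →L[ℂ] H)) (j : ℕ) (v : H) : ℝ :=
  ‖iteratedFDeriv ℝ j (orbitMap π v) (fun i l => (1 : Matrix (Fin 2) (Fin 2) 𝕜) i l)‖

/-- Continuity of a linear functional for the Fréchet topology of `H^∞`. -/
def IsSmoothContinuous (π : GL (Fin 2) 𝕜 →* (H →L[ℂ] H)) (ℓ : smoothVectors π →ₗ[ℂ] ℂ) : Prop :=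
  ∃ (N : ℕ) (C : ℝ), ∀ v : smoothVectors π,
    ‖ℓ v‖ ≤ C * ∑ j ∈ Finset.range (N + 1), smoothSeminorm π j v

/-- The sum of the images in `H` of all intertwining maps from the finite-dimensional
representation `τ` of the maximal compact subgroup. -/
def kIsotypic (π : GL (Fin 2) 𝕜 →* (H →L[ℂ] H)) {n : ℕ}
    (τ : unitaryGL 𝕜 →* GL (Fin n) ℂ) : Submodule ℂ H :=
  ⨆ T ∈ {T : (Fin n → ℂ) →ₗ[ℂ] H | ∀ (k : unitaryGL 𝕜) (x : Fin n → ℂ),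
    T ((τ k).val *ᵥ x) = π k (T x)}, LinearMap.range T

/-- Irreducible admissible representation of `GL₂(𝕜)` on a Banach space: strongly continuous,
without proper non-zero closed invariant subspaces, and with finite multiplicities of
the finite-dimensional continuous representations of the maximal compact subgroup. -/
structure IsIrreducibleAdmissibleArch (π : GL (Fin 2) 𝕜 →* (H →L[ℂ] H)) : Prop where
  continuous : ∀ v : H, Continuous fun g => π g v
  nontrivial : Nontrivial H
  irreducible : ∀ S : Submodule ℂ H, IsClosed (S : Set H) →
    (∀ g, ∀ v ∈ S, π g v ∈ S) → S = ⊥ ∨ S = ⊤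
  admissible : ∀ (n : ℕ) (τ : unitaryGL 𝕜 →* GL (Fin n) ℂ), Continuous τ →
    FiniteDimensional ℂ (kIsotypic π τ)

/-- `ω` is the central character of the Banach representation `π`. -/
def IsCentralCharacterArch (π : GL (Fin 2) 𝕜 →* (H →L[ℂ] H)) (ω : 𝕜ˣ →ₜ* ℂˣ) : Prop :=
  ∀ (z : 𝕜ˣ) (v : H), π (GeneralLinearGroup.scalar (Fin 2) z) v = ((ω z : ℂˣ) : ℂ) • v

/-- The Whittaker functions of `π` with respect to `ψ`: the functions `g ↦ ℓ (π(g) v)` with `v` a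
smooth vector and `ℓ` a continuous Whittaker functional on the space of smooth vectors. -/
def whittakerArch (π : GL (Fin 2) 𝕜 →* (H →L[ℂ] H)) (ψ : AddChar 𝕜 Circle) :
    Set (GL (Fin 2) 𝕜 → ℂ) :=
  {W | ∃ ℓ : smoothVectors π →ₗ[ℂ] ℂ, IsSmoothContinuous π ℓ ∧
    IsWhittakerFunctional (smoothRep π) ψ ℓ ∧
    ∃ v : smoothVectors π, W = fun g => ℓ (smoothRep π g v)}

/-- Schwartz functions on `M₂(𝕜) × M₂(𝕜)`, viewed as a real vector space. -/
def IsSchwartzArch (f : Matrix (Fin 2) (Fin 2) 𝕜 × Matrix (Fin 2) (Fin 2) 𝕜 → ℂ) : Prop :=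
  ∃ φ : 𝓢((Fin 2 → Fin 2 → 𝕜) × (Fin 2 → Fin 2 → 𝕜), ℂ),
    ∀ X Y, f (X, Y) = φ (Matrix.of.symm X, Matrix.of.symm Y)

end Arch

end ZetaTwo

end

/-!
The restriction of a Whittaker function to the torus, `a ↦ W (diag(a, 1) k)`, decays faster than any
power of `‖a‖` as `a → ∞` and grows at most polynomially as `a → 0`, uniformly for `k` in a compact
set. Granting this, multiplying by a quasi-character and by `|a| ^ (s - 1 / 2)` with `Re s` large
gives a bound by any negative power of `max ‖a‖ ‖a‖⁻¹`, which is integrable against Haar measure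
once the power is large. The arguments of `f` are conjugates by compact elements of matrices with
entries `ε⁻¹`, `ε⁻¹ v`, `u ε`, `ε`, from which `u` and `v` are recovered as products of two entries,
so the rapid decrease of `f` controls `u`, `v` and `ε` at once.

Non-archimedean decay: the identity `W (diag(a, 1) u(x) k) = ψ(a x) W (diag(a, 1) k)` and invariance
under a small `u(x)` force `W (diag(a, 1) k) = 0` for large `a`. For `a → 0`, averaging the
translates of the vector by powers of `diag(q, 1)` over a congruence subgroup does not affect these
values, and admissibility puts the averages in a finite-dimensional space; hence the values satisfy
a linear recurrence and grow at most geometrically.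

Archimedean decay: continuity of the functional and Banach–Steinhaus give polynomial growth of
`W (diag(a, 1) g)`. The `M`-th difference of `t ↦ W (diag(a, 1) u(t) k)` with increment `h` is
`(ψ(a h) - 1) ^ M W (diag(a, 1) k)`, and smoothness bounds it by a power of `max ‖a‖ ‖a‖⁻¹`,
independent of `M`, times `‖h‖ ^ M`; taking `h` proportional to `a⁻¹` gives decay of any order.
-/

namespace ZetaTwo

open Filter Topology
open scoped NNReal Matrix.Norms.Elementwise

section Gauge

variable {F : Type*} [NormedField F]

/-- The size `max ‖a‖ ‖a‖⁻¹` of a unit of a normed field, which measures the distance of `a` both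
from `0` and from `∞`. -/
noncomputable def absMax (a : Fˣ) : ℝ := max ‖(a : F)‖ ‖(a : F)‖⁻¹

theorem norm_unit_pos (a : Fˣ) : 0 < ‖(a : F)‖ := norm_pos_iff.2 a.ne_zero

theorem norm_le_absMax (a : Fˣ) : ‖(a : F)‖ ≤ absMax a := le_max_left _ _

theorem one_le_absMax (a : Fˣ) : 1 ≤ absMax a := by
  rcases le_total 1 ‖(a : F)‖ with h | h
  · exact h.trans (norm_le_absMax a)
  · exact ((one_le_inv₀ (norm_unit_pos a)).2 h).trans (le_max_right _ _)

theorem absMax_pos (a : Fˣ) : 0 < absMax a := one_pos.trans_le (one_le_absMax a)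

theorem absMax_of_one_le {a : Fˣ} (h : 1 ≤ ‖(a : F)‖) : absMax a = ‖(a : F)‖ :=
  max_eq_left ((inv_le_one_of_one_le₀ h).trans h)

theorem absMax_of_le_one {a : Fˣ} (h : ‖(a : F)‖ ≤ 1) : absMax a = ‖(a : F)‖⁻¹ :=
  max_eq_right (h.trans ((one_le_inv₀ (norm_unit_pos a)).2 h))

theorem one_lt_absMax {a : Fˣ} (h : ‖(a : F)‖ < 1) : 1 < absMax a := by
  rw [absMax_of_le_one h.le]
  exact (one_lt_inv₀ (norm_unit_pos a)).2 h

theorem absMax_inv (a : Fˣ) : absMax a⁻¹ = absMax a := by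
  simp only [absMax, Units.val_inv_eq_inv_val, norm_inv, inv_inv, max_comm]

theorem continuous_absMax : Continuous (absMax : Fˣ → ℝ) :=
  have h : Continuous fun a : Fˣ => ‖(a : F)‖ := Units.continuous_val.norm
  h.max (h.inv₀ fun a => (norm_unit_pos a).ne')

theorem absMax_mul_of_absMax_lt {q a : Fˣ} (hq : ‖(q : F)‖ < 1) (h : absMax q < absMax a) :
    absMax (q * a) * absMax q = absMax a ∨ absMax (q⁻¹ * a) * absMax q = absMax a := by
  have hq0 := norm_unit_pos q
  rw [absMax_of_le_one hq.le] at h ⊢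
  rcases le_total ‖(a : F)‖ 1 with ha | ha
  · right
    rw [absMax_of_le_one ha, inv_lt_inv₀ hq0 (norm_unit_pos a)] at h
    have hqa : ‖((q⁻¹ * a : Fˣ) : F)‖ ≤ 1 := by
      simpa [inv_mul_le_one₀ hq0] using h.le
    rw [absMax_of_le_one ha, absMax_of_le_one hqa]
    simp only [Units.val_mul, Units.val_inv_eq_inv_val, norm_mul, norm_inv, mul_inv, inv_inv]
    field_simp
  · left
    rw [absMax_of_one_le ha, inv_lt_iff_one_lt_mul₀ hq0, mul_comm] at h
    have hqa : 1 ≤ ‖((q * a : Fˣ) : F)‖ := by simpa using h.le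
    rw [absMax_of_one_le ha, absMax_of_one_le hqa, Units.val_mul, norm_mul]
    field_simp

end Gauge

section LocalField

open scoped ENNReal Pointwise

variable {F : Type*} [NontriviallyNormedField F]

theorem exists_unit_norm_lt_one (F : Type*) [NontriviallyNormedField F] :
    ∃ q : Fˣ, ‖(q : F)‖ < 1 := by
  obtain ⟨x, hx0, hx⟩ := NormedField.exists_norm_lt_one F
  exact ⟨Units.mk0 x (norm_pos_iff.1 hx0), hx⟩

theorem exists_unit_le_norm (F : Type*) [NontriviallyNormedField F] (R : ℝ) :
    ∃ b : Fˣ, R ≤ ‖(b : F)‖ := by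
  obtain ⟨x, hx⟩ := NormedField.exists_lt_norm F (max R 0)
  exact ⟨Units.mk0 x (norm_pos_iff.1 ((le_max_right _ _).trans_lt hx)),
    ((le_max_left _ _).trans_lt hx).le⟩

theorem submultiplicative_le_mul_pow {φ : Fˣ → ℝ} (h0 : ∀ a, 0 ≤ φ a)
    (hmul : ∀ a b, φ (a * b) ≤ φ a * φ b) {q : Fˣ} (hq : ‖(q : F)‖ < 1) {S T : ℝ}
    (hS : ∀ a, absMax a ≤ absMax q → φ a ≤ S) (hT : 1 ≤ T) (hqT : φ q ≤ T) (hqT' : φ q⁻¹ ≤ T)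
    (n : ℕ) : ∀ a, absMax a ≤ absMax q ^ (n + 1) → φ a ≤ S * T ^ n := by
  have hS0 : 0 ≤ S := (h0 q).trans (hS q le_rfl)
  induction n with
  | zero => simpa using hS
  | succ n ih =>
    intro a ha
    rcases le_or_gt (absMax a) (absMax q) with hlt | hlt
    · exact (hS a hlt).trans (le_mul_of_one_le_right hS0 (one_le_pow₀ hT))
    have hstep : ∀ r : Fˣ, φ r⁻¹ ≤ T → absMax (r * a) * absMax q = absMax a →
        φ a ≤ S * T ^ (n + 1) := fun r hr hra => by
      have hra' : absMax (r * a) ≤ absMax q ^ (n + 1) :=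
        le_of_mul_le_mul_right (by rwa [hra, ← pow_succ]) (absMax_pos q)
      calc φ a = φ (r⁻¹ * (r * a)) := by rw [inv_mul_cancel_left]
        _ ≤ φ r⁻¹ * φ (r * a) := hmul _ _
        _ ≤ T * (S * T ^ n) := mul_le_mul hr (ih _ hra') (h0 _) (zero_le_one.trans hT)
        _ = S * T ^ (n + 1) := by ring
    rcases absMax_mul_of_absMax_lt hq hlt with h | h
    · exact hstep q hqT' h
    · exact hstep q⁻¹ (by rwa [inv_inv]) h

theorem submultiplicative_le_absMax_pow {φ : Fˣ → ℝ} (h0 : ∀ a, 0 ≤ φ a)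
    (hmul : ∀ a b, φ (a * b) ≤ φ a * φ b) (hbdd : ∀ R, ∃ C, ∀ a, absMax a ≤ R → φ a ≤ C) :
    ∃ (C : ℝ) (A : ℕ), 0 ≤ C ∧ ∀ a : Fˣ, φ a ≤ C * absMax a ^ A := by
  obtain ⟨q, hq⟩ := exists_unit_norm_lt_one F
  obtain ⟨S, hS⟩ := hbdd (absMax q)
  have hS0 : 0 ≤ S := (h0 q).trans (hS q le_rfl)
  have hR : 1 < absMax q := one_lt_absMax hq
  obtain ⟨A, hA⟩ := pow_unbounded_of_one_lt (max (φ q) (φ q⁻¹)) hR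
  refine ⟨S, A, hS0, fun a => ?_⟩
  obtain ⟨n, hn, hn'⟩ := exists_nat_pow_near (one_le_absMax a) hR
  calc φ a ≤ S * (absMax q ^ A) ^ n :=
        submultiplicative_le_mul_pow h0 hmul hq hS (one_le_pow₀ hR.le)
          ((le_max_left _ _).trans hA.le) ((le_max_right _ _).trans hA.le) n a hn'.le
    _ = S * (absMax q ^ n) ^ A := by rw [pow_right_comm]
    _ ≤ S * absMax a ^ A := by
      gcongr

theorem smul_closedBall_one (a : Fˣ) :
    a • Metric.closedBall (0 : F) 1 = Metric.closedBall 0 ‖(a : F)‖ := by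
  have h := smul_closedBall' a.ne_zero (0 : F) 1
  rwa [smul_zero, mul_one] at h

variable [ProperSpace F]

theorem isCompact_setOf_absMax_le (R : ℝ) : IsCompact {a : Fˣ | absMax a ≤ R} := by
  have himage : ((↑) : Fˣ → F) '' {a : Fˣ | absMax a ≤ R} =
      Metric.closedBall 0 R ∩ {x | 1 ≤ R * ‖x‖} := by
    ext x
    simp only [absMax, Set.mem_image, Set.mem_ofPred_eq, Set.mem_inter_iff, max_le_iff,
      mem_closedBall_zero_iff]
    constructor
    · rintro ⟨a, ⟨h, h'⟩, rfl⟩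
      exact ⟨h, (inv_le_iff_one_le_mul₀ (norm_unit_pos a)).1 h'⟩
    · rintro ⟨h, h'⟩
      have hx : x ≠ 0 := by
        rintro rfl
        simp [zero_lt_one.not_ge] at h'
      exact ⟨Units.mk0 x hx, ⟨h, (inv_le_iff_one_le_mul₀ (norm_pos_iff.2 hx)).2 h'⟩, rfl⟩
  rw [Units.isEmbedding_val₀.isCompact_iff, himage]
  exact (isCompact_closedBall 0 R).inter_right
    (isClosed_le continuous_const (continuous_norm.const_mul R))

theorem norm_quasiChar_le (χ : Fˣ →ₜ* ℂˣ) :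
    ∃ (C : ℝ) (A : ℕ), 0 ≤ C ∧ ∀ a : Fˣ, ‖(χ a : ℂ)‖ ≤ C * absMax a ^ A := by
  refine submultiplicative_le_absMax_pow (fun a => norm_nonneg _) (fun a b => by simp)
    fun R => ?_
  have hcont : Continuous fun a : Fˣ => ‖(χ a : ℂ)‖ :=
    (Units.continuous_val.comp χ.continuous_toFun).norm
  obtain ⟨C, hC⟩ := (isCompact_setOf_absMax_le R).exists_bound_of_continuousOn hcont.continuousOn
  exact ⟨C, fun a ha => by simpa using hC a ha⟩

variable [MeasurableSpace F] [BorelSpace F]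

instance borelSpace_units : BorelSpace Fˣ where
  measurable_eq := by
    rw [Units.isEmbedding_val₀.eq_induced, borel_comap, ← BorelSpace.measurable_eq (α := F)]
    rfl

instance secondCountableTopology_units : SecondCountableTopology Fˣ :=
  Units.isEmbedding_val₀.secondCountableTopology

theorem normAbs_pos (a : Fˣ) : 0 < normAbs a := distribHaarChar_pos

theorem normAbs_mul (a b : Fˣ) : normAbs (a * b) = normAbs a * normAbs b := by
  simp [normAbs]

theorem normAbs_pow (a : Fˣ) (n : ℕ) : normAbs (a ^ n) = normAbs a ^ n := by
  simp [normAbs]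

theorem normAbs_inv (a : Fˣ) : normAbs a⁻¹ = (normAbs a)⁻¹ := by
  simp [normAbs]

theorem measure_closedBall_norm (dx : Measure F) [dx.IsAddHaarMeasure] (a : Fˣ) :
    dx (Metric.closedBall 0 ‖(a : F)‖) =
      ENNReal.ofReal (normAbs a) * dx (Metric.closedBall 0 1) := by
  rw [← smul_closedBall_one, ← distribHaarChar_mul]
  simp [normAbs]

theorem normAbs_eq_div (dx : Measure F) [dx.IsAddHaarMeasure] (a : Fˣ) :
    normAbs a = dx.real (Metric.closedBall 0 ‖(a : F)‖) / dx.real (Metric.closedBall 0 1) := by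
  have hB : dx (Metric.closedBall 0 1) ≠ ∞ := (isCompact_closedBall 0 1).measure_ne_top
  have hB0 : 0 < dx (Metric.closedBall 0 1) := Metric.measure_closedBall_pos _ _ one_pos
  rw [measureReal_def, measure_closedBall_norm, ENNReal.toReal_mul,
    ENNReal.toReal_ofReal (normAbs_pos a).le, measureReal_def,
    mul_div_cancel_right₀ _ (ENNReal.toReal_pos hB0.ne' hB).ne']

theorem normAbs_le_of_norm_le {a b : Fˣ} (h : ‖(a : F)‖ ≤ ‖(b : F)‖) : normAbs a ≤ normAbs b := by
  rw [normAbs_eq_div Measure.addHaar a, normAbs_eq_div Measure.addHaar b]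
  exact div_le_div_of_nonneg_right (measureReal_mono (Metric.closedBall_subset_closedBall h)
    (isCompact_closedBall 0 _).measure_ne_top) measureReal_nonneg

theorem normAbs_lt_one {q : Fˣ} (hq : ‖(q : F)‖ < 1) : normAbs q < 1 := by
  let dx : Measure F := Measure.addHaar
  let shell : Set F := {x | ‖(q : F)‖ ^ 2 < ‖x‖} ∩ {x | ‖x‖ < 1}
  have hopen : IsOpen shell :=
    (isOpen_lt continuous_const continuous_norm).inter (isOpen_lt continuous_norm continuous_const)
  have hq_mem : (q : F) ∈ shell := ⟨pow_lt_self_of_lt_one₀ (norm_unit_pos q) hq one_lt_two, hq⟩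
  have hshell_sub : shell ⊆ Metric.closedBall 0 1 := fun x hx => mem_closedBall_zero_iff.2 hx.2.le
  have hfin : dx shell ≠ ∞ :=
    measure_ne_top_of_subset hshell_sub (isCompact_closedBall 0 1).measure_ne_top
  have hpos : 0 < dx.real shell := ENNReal.toReal_pos (hopen.measure_pos dx ⟨q, hq_mem⟩).ne' hfin
  have hdisj : Disjoint (Metric.closedBall (0 : F) ‖((q ^ 2 : Fˣ) : F)‖) shell :=
    Set.disjoint_left.2 fun x hx hx' => by
      simp only [mem_closedBall_zero_iff, Units.val_pow_eq_pow_val, norm_pow] at hx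
      exact hx'.1.not_ge hx
  have hsub : Metric.closedBall (0 : F) ‖((q ^ 2 : Fˣ) : F)‖ ∪ shell ⊆ Metric.closedBall 0 1 :=
    Set.union_subset (Metric.closedBall_subset_closedBall (by
      simpa using hq.le)) hshell_sub
  have hsq : normAbs (q ^ 2) < 1 := by
    have hadd := measureReal_mono (μ := dx) hsub (isCompact_closedBall 0 1).measure_ne_top
    rw [measureReal_union hdisj hopen.measurableSet
      (isCompact_closedBall 0 _).measure_ne_top hfin] at hadd
    have hnonneg : 0 ≤ dx.real (Metric.closedBall 0 ‖((q ^ 2 : Fˣ) : F)‖) := measureReal_nonneg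
    rw [normAbs_eq_div dx, div_lt_one (by linarith)]
    linarith
  rw [normAbs_pow] at hsq
  exact (pow_lt_one_iff_of_nonneg (normAbs_pos q).le two_ne_zero).1 hsq

theorem measurable_normAbs : Measurable (normAbs : Fˣ → ℝ) := by
  let dx : Measure F := Measure.addHaar
  have hset : MeasurableSet {p : Fˣ × F | ‖p.2‖ ≤ ‖(p.1 : F)‖} :=
    (isClosed_le (by fun_prop) (by fun_prop)).measurableSet
  have hball : Measurable fun a : Fˣ => dx.real (Metric.closedBall 0 ‖(a : F)‖) := by
    have := (measurable_measure_prodMk_left (ν := dx) hset).ennreal_toReal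
    simpa [Measure.real, Metric.closedBall, dist_zero_right] using this
  simp only [funext (normAbs_eq_div dx)]
  exact hball.div_const _

theorem exists_normAbs_pow_le : ∃ (A : ℕ) (C : ℝ), 0 ≤ C ∧ ∀ a : Fˣ, ‖(a : F)‖ ≤ 1 →
    normAbs a ^ A ≤ C * ‖(a : F)‖ := by
  obtain ⟨q, hq⟩ := exists_unit_norm_lt_one F
  have hq0 := norm_unit_pos q
  obtain ⟨A, hA⟩ := exists_pow_lt_of_lt_one hq0 (normAbs_lt_one hq)
  refine ⟨A, ‖(q : F)‖⁻¹, inv_nonneg.2 hq0.le, fun a ha => ?_⟩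
  obtain ⟨n, hn, hn'⟩ := exists_nat_pow_near_of_lt_one (norm_unit_pos a) ha hq0 hq
  calc normAbs a ^ A ≤ normAbs (q ^ n) ^ A :=
        pow_le_pow_left₀ (normAbs_pos a).le (normAbs_le_of_norm_le (by simpa using hn')) A
    _ = (normAbs q ^ A) ^ n := by rw [normAbs_pow, pow_right_comm]
    _ ≤ ‖(q : F)‖ ^ n := pow_le_pow_left₀ (pow_nonneg (normAbs_pos q).le A) hA.le n
    _ = ‖(q : F)‖⁻¹ * ‖(q : F)‖ ^ (n + 1) := by rw [pow_succ]; field_simp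
    _ ≤ ‖(q : F)‖⁻¹ * ‖(a : F)‖ := by gcongr

end LocalField

section Integrability

open scoped ENNReal

theorem exists_integrable_inv_pow {X : Type*} [MeasurableSpace X] {ν : Measure X} {N : X → ℝ}
    (hN : Measurable N) (h1 : ∀ x, 1 ≤ N x) {R : ℝ} (hR : 1 < R) {C : ℝ≥0∞} (hC : C ≠ ∞) {Q : ℝ≥0}
    (h : ∀ n : ℕ, ν {x | N x ≤ R ^ (n + 1)} ≤ C * Q ^ n) :
    ∃ P : ℕ, Integrable (fun x => (N x)⁻¹ ^ P) ν := by
  have hR0 : 0 < R := one_pos.trans hR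
  obtain ⟨P, hP⟩ := pow_unbounded_of_one_lt (Q : ℝ) hR
  refine ⟨P, (hN.inv.pow_const P).aestronglyMeasurable, ?_⟩
  set t : ℝ≥0∞ := ENNReal.ofReal (R⁻¹ ^ P) with ht
  have htQ : t * Q < 1 := by
    rw [ht, ← ENNReal.ofReal_coe_nnreal, ← ENNReal.ofReal_mul (by positivity),
      ENNReal.ofReal_lt_one, inv_pow, inv_mul_lt_one₀ (pow_pos hR0 P)]
    exact hP
  have hmeas : ∀ n : ℕ, MeasurableSet {x | N x ≤ R ^ (n + 1)} := fun n =>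
    measurableSet_le hN measurable_const
  have hlayer : ∀ x, ‖(N x)⁻¹ ^ P‖ₑ ≤
      ∑' n : ℕ, Set.indicator {x | N x ≤ R ^ (n + 1)} (fun _ => t ^ n) x := fun x => by
    obtain ⟨n, hn, hn'⟩ := exists_nat_pow_near (h1 x) hR
    have hx : 0 < N x := one_pos.trans_le (h1 x)
    refine le_trans ?_ (ENNReal.le_tsum n)
    rw [Set.indicator_of_mem (show x ∈ {x | N x ≤ R ^ (n + 1)} from hn'.le),
      Real.enorm_eq_ofReal (by positivity), ht, ← ENNReal.ofReal_pow (by positivity),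
      pow_right_comm, inv_pow R n]
    exact ENNReal.ofReal_le_ofReal (by gcongr)
  calc ∫⁻ x, ‖(N x)⁻¹ ^ P‖ₑ ∂ν
      ≤ ∫⁻ x, ∑' n : ℕ, Set.indicator {x | N x ≤ R ^ (n + 1)} (fun _ => t ^ n) x ∂ν :=
        lintegral_mono hlayer
    _ = ∑' n : ℕ, t ^ n * ν {x | N x ≤ R ^ (n + 1)} := by
        rw [lintegral_tsum fun n => (measurable_const.indicator (hmeas n)).aemeasurable]
        simp only [lintegral_indicator_const (hmeas _)]
    _ ≤ ∑' n : ℕ, C * (t * Q) ^ n := by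
        refine ENNReal.tsum_le_tsum fun n => ?_
        rw [mul_pow, mul_left_comm]
        exact mul_le_mul_right (h n) _
    _ = C * (1 - t * Q)⁻¹ := by rw [ENNReal.tsum_mul_left, ENNReal.tsum_geometric]
    _ < ∞ := ENNReal.mul_lt_top hC.lt_top (ENNReal.inv_lt_top.2 (tsub_pos_of_lt htQ))

variable {F : Type*} [NontriviallyNormedField F] [MeasurableSpace F] [BorelSpace F]

theorem measure_absMax_le_pow (dt : Measure Fˣ) [dt.IsHaarMeasure] {q : Fˣ}
    (hq : ‖(q : F)‖ < 1) (n : ℕ) :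
    dt {a | absMax a ≤ absMax q ^ (n + 1)} ≤ dt {a | absMax a ≤ absMax q} * 3 ^ n := by
  induction n with
  | zero => simp
  | succ n ih =>
    set S : Set Fˣ := {a | absMax a ≤ absMax q ^ (n + 1)}
    have hcover : {a | absMax a ≤ absMax q ^ (n + 2)} ⊆
        S ∪ (fun a => q * a) ⁻¹' S ∪ (fun a => q⁻¹ * a) ⁻¹' S := fun a ha => by
      have hscale : ∀ r : Fˣ, absMax (r * a) * absMax q = absMax a → r * a ∈ S := fun r hr =>
        le_of_mul_le_mul_right (by rwa [hr, ← pow_succ]) (absMax_pos q)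
      rcases le_or_gt (absMax a) (absMax q) with hlt | hlt
      · exact .inl (.inl (hlt.trans (le_self_pow₀ (one_le_absMax q) n.succ_ne_zero)))
      · rcases absMax_mul_of_absMax_lt hq hlt with h | h
        · exact .inl (.inr (hscale q h))
        · exact .inr (hscale q⁻¹ h)
    calc dt {a | absMax a ≤ absMax q ^ (n + 2)}
        ≤ dt S + dt ((fun a => q * a) ⁻¹' S) + dt ((fun a => q⁻¹ * a) ⁻¹' S) :=
          (measure_mono hcover).trans ((measure_union_le _ _).trans
            (add_le_add_left (measure_union_le _ _) _))
      _ = dt S * 3 := by rw [measure_preimage_mul, measure_preimage_mul]; ring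
      _ ≤ dt {a | absMax a ≤ absMax q} * 3 ^ (n + 1) := by
          rw [pow_succ, ← mul_assoc]
          gcongr

variable [ProperSpace F]

theorem exists_integrable_inv_one_add_norm_pow (dx : Measure F) [dx.IsAddHaarMeasure] :
    ∃ P : ℕ, Integrable (fun u : F => (1 + ‖u‖)⁻¹ ^ P) dx := by
  obtain ⟨q, hq⟩ := NormedField.exists_one_lt_norm F
  let b : Fˣ := Units.mk0 q (norm_pos_iff.1 (one_pos.trans hq))
  have hB : dx (Metric.closedBall 0 1) ≠ ∞ := (isCompact_closedBall 0 1).measure_ne_top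
  refine exists_integrable_inv_pow (by fun_prop) (fun u => by simp) hq
    (C := ENNReal.ofReal (normAbs b) * dx (Metric.closedBall 0 1))
    (ENNReal.mul_ne_top ENNReal.ofReal_ne_top hB) (Q := (normAbs b).toNNReal) fun n => ?_
  calc dx {u : F | 1 + ‖u‖ ≤ ‖q‖ ^ (n + 1)}
      ≤ dx (Metric.closedBall 0 ‖((b ^ (n + 1) : Fˣ) : F)‖) := measure_mono fun u hu => by
        simpa [b] using (le_add_of_nonneg_left zero_le_one).trans hu
    _ = ENNReal.ofReal (normAbs b) * dx (Metric.closedBall 0 1) * (normAbs b).toNNReal ^ n := by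
        rw [measure_closedBall_norm, normAbs_pow, ENNReal.ofReal_pow (normAbs_pos b).le, pow_succ']
        exact mul_right_comm _ _ _

theorem exists_integrable_inv_absMax_pow (dt : Measure Fˣ) [dt.IsHaarMeasure] :
    ∃ P : ℕ, Integrable (fun a : Fˣ => (absMax a)⁻¹ ^ P) dt := by
  obtain ⟨q, hq⟩ := exists_unit_norm_lt_one F
  exact exists_integrable_inv_pow continuous_absMax.measurable one_le_absMax (one_lt_absMax hq)
    (isCompact_setOf_absMax_le (absMax q)).measure_ne_top (Q := 3)
    fun n => by simpa using measure_absMax_le_pow dt hq n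

end Integrability

section TorusDecay

variable {F : Type*} [NontriviallyNormedField F]

/-- Uniformly for `k ∈ S`, the function `a ↦ W (diag(a, 1) k)` is rapidly decreasing as `a → ∞` and
of at most polynomial growth as `a → 0`. One inequality encodes both: the large exponents `M` give
the decay at infinity, a single one gives the growth at zero. -/
def HasTorusDecay (S : Set (GL (Fin 2) F)) (W : GL (Fin 2) F → ℂ) : Prop :=
  ∃ B : ℕ, ∀ M ≥ B, ∃ C : ℝ, ∀ k ∈ S, ∀ a : Fˣ, ‖W (diagOne a * k)‖ * ‖(a : F)‖ ^ M ≤ C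

variable {S : Set (GL (Fin 2) F)} {W : GL (Fin 2) F → ℂ}

theorem HasTorusDecay.exists_le_absMax_pow (hW : HasTorusDecay S W) :
    ∃ (C : ℝ) (B : ℕ), 0 ≤ C ∧ ∀ k ∈ S, ∀ a : Fˣ, ‖(a : F)‖ ≤ 1 →
      ‖W (diagOne a * k)‖ ≤ C * absMax a ^ B := by
  obtain ⟨B, hB⟩ := hW
  obtain ⟨C, hC⟩ := hB B le_rfl
  refine ⟨|C|, B, abs_nonneg C, fun k hk a ha => ?_⟩
  rw [absMax_of_le_one ha, inv_pow, ← div_eq_mul_inv, le_div_iff₀ (pow_pos (norm_unit_pos a) B)]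
  exact (hC k hk a).trans (le_abs_self C)

theorem HasTorusDecay.exists_le_inv_absMax_pow (hW : HasTorusDecay S W) (P : ℕ) :
    ∃ C : ℝ, 0 ≤ C ∧ ∀ k ∈ S, ∀ a : Fˣ, 1 ≤ ‖(a : F)‖ →
      ‖W (diagOne a * k)‖ ≤ C * (absMax a)⁻¹ ^ P := by
  obtain ⟨B, hB⟩ := hW
  obtain ⟨C, hC⟩ := hB (max B P) (le_max_left B P)
  refine ⟨|C|, abs_nonneg C, fun k hk a ha => ?_⟩
  rw [absMax_of_one_le ha, inv_pow, ← div_eq_mul_inv, le_div_iff₀ (pow_pos (norm_unit_pos a) P)]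
  calc ‖W (diagOne a * k)‖ * ‖(a : F)‖ ^ P
      ≤ ‖W (diagOne a * k)‖ * ‖(a : F)‖ ^ max B P := by gcongr; exact le_max_right B P
    _ ≤ |C| := (hC k hk a).trans (le_abs_self C)

variable [ProperSpace F] [MeasurableSpace F] [BorelSpace F]

theorem norm_absPow (a : Fˣ) (s : ℂ) : ‖absPow a s‖ = normAbs a ^ s.re :=
  Complex.norm_cpow_eq_rpow_re_of_pos (normAbs_pos a) s

theorem norm_absPow_le (F : Type*) [NontriviallyNormedField F] [ProperSpace F] [MeasurableSpace F]
    [BorelSpace F] (s : ℂ) :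
    ∃ (C : ℝ) (A : ℕ), 0 ≤ C ∧ ∀ a : Fˣ, ‖absPow a s‖ ≤ C * absMax a ^ A := by
  refine submultiplicative_le_absMax_pow (fun a => norm_nonneg _) (fun a b => ?_) fun R => ?_
  · simp only [norm_absPow, normAbs_mul, Real.mul_rpow (normAbs_pos a).le (normAbs_pos b).le,
      le_rfl]
  obtain ⟨b, hb⟩ := exists_unit_le_norm F R
  have hle : ∀ a : Fˣ, absMax a ≤ R → normAbs a ≤ normAbs b := fun a ha =>
    normAbs_le_of_norm_le ((norm_le_absMax a).trans (ha.trans hb))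
  refine ⟨normAbs b ^ |s.re|, fun a ha => ?_⟩
  rw [norm_absPow]
  rcases le_total 0 s.re with hs | hs
  · rw [abs_of_nonneg hs]
    exact Real.rpow_le_rpow (normAbs_pos a).le (hle a ha) hs
  · rw [abs_of_nonpos hs, ← inv_inv a, normAbs_inv, Real.inv_rpow (normAbs_pos _).le,
      ← Real.rpow_neg (normAbs_pos _).le]
    exact Real.rpow_le_rpow (normAbs_pos _).le (hle a⁻¹ (by rwa [absMax_inv])) (neg_nonneg.2 hs)

theorem measurable_absPow (s : ℂ) : Measurable fun a : Fˣ => absPow a s :=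
  (Complex.measurable_ofReal.comp measurable_normAbs).pow_const s

theorem exists_normAbs_rpow_le (F : Type*) [NontriviallyNormedField F] [ProperSpace F]
    [MeasurableSpace F] [BorelSpace F] (Q : ℕ) :
    ∃ c C : ℝ, 0 ≤ C ∧ ∀ σ ≥ c, ∀ a : Fˣ, ‖(a : F)‖ ≤ 1 → normAbs a ^ σ ≤ C * ‖(a : F)‖ ^ Q := by
  obtain ⟨A, C, hC, hA⟩ := exists_normAbs_pow_le (F := F)
  refine ⟨(A * Q : ℕ), C ^ Q, pow_nonneg hC Q, fun σ hσ a ha => ?_⟩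
  have hle : normAbs a ≤ 1 := by
    simpa [normAbs] using normAbs_le_of_norm_le (b := 1) (by simpa using ha)
  calc normAbs a ^ σ ≤ normAbs a ^ ((A * Q : ℕ) : ℝ) :=
        Real.rpow_le_rpow_of_exponent_ge (normAbs_pos a) hle hσ
    _ = (normAbs a ^ A) ^ Q := by rw [Real.rpow_natCast, pow_mul]
    _ ≤ (C * ‖(a : F)‖) ^ Q := pow_le_pow_left₀ (pow_nonneg (normAbs_pos a).le A) (hA a ha) Q
    _ = C ^ Q * ‖(a : F)‖ ^ Q := mul_pow _ _ _

theorem norm_torusIntegrand (ψ : AddChar F Circle) (W : GL (Fin 2) F → ℂ) (χ : Fˣ →ₜ* ℂˣ) (s : ℂ)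
    (k : GL (Fin 2) F) (u : F) (a : Fˣ) :
    ‖torusIntegrand ψ W χ s k u a‖ =
      ‖W (diagOne a * k)‖ * ‖(χ a : ℂ)‖ * ‖absPow a (s - 1 / 2)‖ := by
  simp only [torusIntegrand, norm_mul, Circle.norm_coe, mul_one]

theorem HasTorusDecay.norm_torusIntegrand_le_of_norm_le_one (hW : HasTorusDecay S W)
    (ψ : AddChar F Circle) (χ : Fˣ →ₜ* ℂˣ) (P : ℕ) :
    ∃ c C : ℝ, 0 ≤ C ∧ ∀ s : ℂ, c < s.re → ∀ k ∈ S, ∀ (u : F) (a : Fˣ), ‖(a : F)‖ ≤ 1 →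
      ‖torusIntegrand ψ W χ s k u a‖ ≤ C * (absMax a)⁻¹ ^ P := by
  obtain ⟨C₁, B, hC₁, hW⟩ := hW.exists_le_absMax_pow
  obtain ⟨C₂, A, hC₂, hχ⟩ := norm_quasiChar_le χ
  obtain ⟨c, C₃, hC₃, hpow⟩ := exists_normAbs_rpow_le F (B + A + P)
  refine ⟨c + 1 / 2, C₁ * C₂ * C₃, by positivity, fun s hs k hk u a ha => ?_⟩
  have hσ : c ≤ (s - 1 / 2).re := by
    rw [Complex.sub_re, Complex.div_ofNat_re, Complex.one_re]
    linarith
  have habs : ‖absPow a (s - 1 / 2)‖ ≤ C₃ * (absMax a)⁻¹ ^ (B + A + P) := by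
    rw [norm_absPow, absMax_of_le_one ha, inv_inv]
    exact hpow _ hσ a ha
  have hm := absMax_pos a
  rw [norm_torusIntegrand]
  calc ‖W (diagOne a * k)‖ * ‖(χ a : ℂ)‖ * ‖absPow a (s - 1 / 2)‖
      ≤ C₁ * absMax a ^ B * (C₂ * absMax a ^ A) * (C₃ * (absMax a)⁻¹ ^ (B + A + P)) := by
        gcongr
        exacts [hW k hk a ha, hχ a]
    _ = C₁ * C₂ * C₃ * (absMax a)⁻¹ ^ P := by
        rw [inv_pow, pow_add, pow_add, inv_pow]
        field_simp

theorem HasTorusDecay.norm_torusIntegrand_le_of_one_le_norm (hW : HasTorusDecay S W)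
    (ψ : AddChar F Circle) (χ : Fˣ →ₜ* ℂˣ) (s : ℂ) (P : ℕ) :
    ∃ C : ℝ, 0 ≤ C ∧ ∀ k ∈ S, ∀ (u : F) (a : Fˣ), 1 ≤ ‖(a : F)‖ →
      ‖torusIntegrand ψ W χ s k u a‖ ≤ C * (absMax a)⁻¹ ^ P := by
  obtain ⟨C₂, A, hC₂, hχ⟩ := norm_quasiChar_le χ
  obtain ⟨C₃, A', hC₃, habs⟩ := norm_absPow_le F (s - 1 / 2)
  obtain ⟨C₁, hC₁, hW⟩ := hW.exists_le_inv_absMax_pow (A + A' + P)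
  refine ⟨C₁ * C₂ * C₃, by positivity, fun k hk u a ha => ?_⟩
  have hm := absMax_pos a
  rw [norm_torusIntegrand]
  calc ‖W (diagOne a * k)‖ * ‖(χ a : ℂ)‖ * ‖absPow a (s - 1 / 2)‖
      ≤ C₁ * (absMax a)⁻¹ ^ (A + A' + P) * (C₂ * absMax a ^ A) * (C₃ * absMax a ^ A') := by
        gcongr
        exacts [hW k hk a ha, hχ a, habs a]
    _ = C₁ * C₂ * C₃ * (absMax a)⁻¹ ^ P := by
        rw [inv_pow, pow_add, pow_add, inv_pow]
        field_simp

theorem HasTorusDecay.norm_torusIntegrand_le (hW : HasTorusDecay S W) (ψ : AddChar F Circle)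
    (χ : Fˣ →ₜ* ℂˣ) (P : ℕ) :
    ∃ c : ℝ, ∀ s : ℂ, c < s.re → ∃ C : ℝ, ∀ k ∈ S, ∀ (u : F) (a : Fˣ),
      ‖torusIntegrand ψ W χ s k u a‖ ≤ C * (absMax a)⁻¹ ^ P := by
  obtain ⟨c, C₁, hC₁, hsmall⟩ := hW.norm_torusIntegrand_le_of_norm_le_one ψ χ P
  refine ⟨c, fun s hs => ?_⟩
  obtain ⟨C₂, hC₂, hlarge⟩ := hW.norm_torusIntegrand_le_of_one_le_norm ψ χ s P
  refine ⟨C₁ + C₂, fun k hk u a => ?_⟩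
  have hm : 0 ≤ (absMax a)⁻¹ ^ P := pow_nonneg (inv_nonneg.2 (absMax_pos a).le) P
  rw [add_mul]
  rcases le_total ‖(a : F)‖ 1 with ha | ha
  · exact (hsmall s hs k hk u a ha).trans (le_add_of_nonneg_right (mul_nonneg hC₂ hm))
  · exact (hlarge k hk u a ha).trans (le_add_of_nonneg_left (mul_nonneg hC₁ hm))

end TorusDecay

section RapidDecrease

/-- `f` decays faster than every power of the norm. Both Schwartz functions over an archimedean
field and Schwartz–Bruhat functions over a non-archimedean one have this property. -/
def IsRapidlyDecreasing {E : Type*} [SeminormedAddCommGroup E] (f : E → ℂ) : Prop :=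
  ∀ P : ℕ, ∃ C : ℝ, ∀ x, ‖f x‖ * (1 + ‖x‖) ^ P ≤ C

theorem isRapidlyDecreasing_of_hasCompactSupport {E : Type*} [SeminormedAddCommGroup E]
    {f : E → ℂ} (hf : HasCompactSupport f) (hcont : Continuous f) :
    IsRapidlyDecreasing f := fun P => by
  have hcont' : Continuous fun x => f x * ((1 + ‖x‖ : ℝ) : ℂ) ^ P := by fun_prop
  obtain ⟨C, hC⟩ := hcont'.bounded_above_of_compact_support hf.mul_right
  refine ⟨C, fun x => (le_of_eq ?_).trans (hC x)⟩
  rw [norm_mul, norm_pow, Complex.norm_real, Real.norm_of_nonneg (by positivity)]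

theorem isRapidlyDecreasing_schwartzMap {E : Type*} [NormedAddCommGroup E] [NormedSpace ℝ E]
    (φ : 𝓢(E, ℂ)) : IsRapidlyDecreasing φ := fun P =>
  ⟨_, fun x => by
    simpa [mul_comm] using
      SchwartzMap.one_add_le_sup_seminorm_apply (𝕜 := ℝ) (m := (P, 0)) le_rfl le_rfl φ x⟩

variable {F : Type*} [NormedField F]

theorem norm_mul_fin_two_le (A B : Matrix (Fin 2) (Fin 2) F) : ‖A * B‖ ≤ 2 * ‖A‖ * ‖B‖ := by
  refine (Matrix.norm_le_iff (by positivity)).2 fun i j => ?_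
  rw [Matrix.mul_apply, Fin.sum_univ_two]
  calc ‖A i 0 * B 0 j + A i 1 * B 1 j‖ ≤ ‖A i 0‖ * ‖B 0 j‖ + ‖A i 1‖ * ‖B 1 j‖ := by
        simpa only [norm_mul] using norm_add_le (A i 0 * B 0 j) (A i 1 * B 1 j)
    _ ≤ ‖A‖ * ‖B‖ + ‖A‖ * ‖B‖ := by
        gcongr <;> exact Matrix.norm_entry_le_entrywise_sup_norm _
    _ = 2 * ‖A‖ * ‖B‖ := by ring

theorem exists_norm_le_norm_inv_mul_mul {S : Set (GL (Fin 2) F)} (hS : IsCompact S) :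
    ∃ D : ℝ, 1 ≤ D ∧ ∀ k₁ ∈ S, ∀ k₂ ∈ S, ∀ X : Matrix (Fin 2) (Fin 2) F,
      ‖X‖ ≤ D * ‖(k₁⁻¹).val * X * k₂.val‖ := by
  obtain ⟨B, hB⟩ := hS.exists_bound_of_continuousOn (f := fun k : GL (Fin 2) F => k.val)
    Units.continuous_val.continuousOn
  obtain ⟨B', hB'⟩ := hS.exists_bound_of_continuousOn (f := fun k : GL (Fin 2) F => (k⁻¹).val)
    Units.continuous_coe_inv.continuousOn
  refine ⟨max 1 (4 * B * B'), le_max_left _ _, fun k₁ hk₁ k₂ hk₂ X => ?_⟩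
  set Y := (k₁⁻¹).val * X * k₂.val with hY
  have hX : X = k₁.val * Y * (k₂⁻¹).val := by
    simp [hY, Matrix.mul_assoc]
  have hB0 : 0 ≤ B := (norm_nonneg _).trans (hB k₁ hk₁)
  calc ‖X‖ = ‖k₁.val * Y * (k₂⁻¹).val‖ := by rw [← hX]
    _ ≤ 2 * (2 * ‖k₁.val‖ * ‖Y‖) * ‖(k₂⁻¹).val‖ :=
        (norm_mul_fin_two_le _ _).trans (by gcongr; exact norm_mul_fin_two_le _ _)
    _ ≤ 2 * (2 * B * ‖Y‖) * B' := by
        gcongr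
        exacts [hB k₁ hk₁, hB' k₂ hk₂]
    _ = 4 * B * B' * ‖Y‖ := by ring
    _ ≤ max 1 (4 * B * B') * ‖Y‖ := by gcongr; exact le_max_right _ _

theorem IsRapidlyDecreasing.norm_inv_mul_mul_le
    {f : Matrix (Fin 2) (Fin 2) F × Matrix (Fin 2) (Fin 2) F → ℂ} (hf : IsRapidlyDecreasing f)
    {S : Set (GL (Fin 2) F)} (hS : IsCompact S) (E : ℕ) :
    ∃ C : ℝ, 0 ≤ C ∧ ∀ k₁ ∈ S, ∀ k₂ ∈ S, ∀ X Y : Matrix (Fin 2) (Fin 2) F,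
      ‖f ((k₁⁻¹).val * X * k₂.val, (k₁⁻¹).val * Y * k₂.val)‖ * (1 + ‖(X, Y)‖) ^ E ≤ C := by
  obtain ⟨D, hD, hconj⟩ := exists_norm_le_norm_inv_mul_mul hS
  obtain ⟨C, hC⟩ := hf E
  have : 0 ≤ D := zero_le_one.trans hD
  have hC0 : 0 ≤ C := le_trans (by positivity) (hC 0)
  refine ⟨D ^ E * C, by positivity, fun k₁ hk₁ k₂ hk₂ X Y => ?_⟩
  set Z := ((k₁⁻¹).val * X * k₂.val, (k₁⁻¹).val * Y * k₂.val)
  have hZ : 1 + ‖(X, Y)‖ ≤ D * (1 + ‖Z‖) := by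
    have hXY : ‖(X, Y)‖ ≤ D * ‖Z‖ := (Prod.norm_mk X Y).trans_le <| max_le
      ((hconj k₁ hk₁ k₂ hk₂ X).trans (by gcongr; exact norm_fst_le Z))
      ((hconj k₁ hk₁ k₂ hk₂ Y).trans (by gcongr; exact norm_snd_le Z))
    linarith
  calc ‖f Z‖ * (1 + ‖(X, Y)‖) ^ E ≤ ‖f Z‖ * (D * (1 + ‖Z‖)) ^ E := by gcongr
    _ = D ^ E * (‖f Z‖ * (1 + ‖Z‖) ^ E) := by rw [mul_pow, mul_left_comm]
    _ ≤ D ^ E * C := by gcongr; exact hC Z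

end RapidDecrease

section Weight

variable {F : Type*} [NormedField F]

theorem gauge_mul_le (u v : F) (ε : Fˣ) (P Q : ℕ) :
    (1 + ‖u‖) ^ P * (1 + ‖v‖) ^ P * absMax ε ^ Q ≤
      (1 + ‖((!![(ε : F)⁻¹, (ε : F)⁻¹ * v; 0, 0], !![0, -u * (ε : F); 0, (ε : F)]) :
        Matrix (Fin 2) (Fin 2) F × Matrix (Fin 2) (Fin 2) F)‖) ^ (4 * P + Q) := by
  set X : Matrix (Fin 2) (Fin 2) F := !![(ε : F)⁻¹, (ε : F)⁻¹ * v; 0, 0]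
  set Y : Matrix (Fin 2) (Fin 2) F := !![0, -u * (ε : F); 0, (ε : F)]
  set n := ‖(X, Y)‖
  have hX : ∀ i j, ‖X i j‖ ≤ n := fun i j =>
    (Matrix.norm_entry_le_entrywise_sup_norm X).trans (norm_fst_le (X, Y))
  have hY : ∀ i j, ‖Y i j‖ ≤ n := fun i j =>
    (Matrix.norm_entry_le_entrywise_sup_norm Y).trans (norm_snd_le (X, Y))
  have hn : 0 ≤ n := norm_nonneg _
  have hε : ‖(ε : F)‖ ≤ n := hY 1 1
  have hε' : ‖(ε : F)⁻¹‖ ≤ n := hX 0 0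
  have hu : ‖u‖ ≤ n * n := by
    calc ‖u‖ = ‖-u * (ε : F)‖ * ‖(ε : F)⁻¹‖ := by
          rw [← norm_mul, mul_inv_cancel_right₀ ε.ne_zero, norm_neg]
      _ ≤ n * n := mul_le_mul (hY 0 1) hε' (norm_nonneg _) hn
  have hv : ‖v‖ ≤ n * n := by
    calc ‖v‖ = ‖(ε : F)‖ * ‖(ε : F)⁻¹ * v‖ := by
          rw [← norm_mul, mul_inv_cancel_left₀ ε.ne_zero]
      _ ≤ n * n := mul_le_mul hε (hX 0 1) (norm_nonneg _) hn
  have hsq : ∀ {w : F}, ‖w‖ ≤ n * n → 1 + ‖w‖ ≤ (1 + n) ^ 2 := fun hw => by nlinarith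
  have habs : absMax ε ≤ 1 + n :=
    (max_le hε (by rwa [← norm_inv])).trans (le_add_of_nonneg_left zero_le_one)
  have hm := absMax_pos ε
  calc (1 + ‖u‖) ^ P * (1 + ‖v‖) ^ P * absMax ε ^ Q
      ≤ ((1 + n) ^ 2) ^ P * ((1 + n) ^ 2) ^ P * (1 + n) ^ Q := by
        gcongr
        exacts [hsq hu, hsq hv]
    _ = (1 + n) ^ (4 * P + Q) := by rw [← pow_mul, ← pow_add, ← pow_add]; ring_nf

end Weight

section Bounds

variable {F : Type*} [NontriviallyNormedField F] [ProperSpace F] [MeasurableSpace F] [BorelSpace F]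

theorem IsRapidlyDecreasing.norm_schwartzWeight_le
    {f : Matrix (Fin 2) (Fin 2) F × Matrix (Fin 2) (Fin 2) F → ℂ} (hf : IsRapidlyDecreasing f)
    {S : Set (GL (Fin 2) F)} (hS : IsCompact S) (ω : Fˣ →ₜ* ℂˣ) (s : ℂ) (P Q : ℕ) :
    ∃ C : ℝ, ∀ (u v : F) (ε : Fˣ), ∀ k₁ ∈ S, ∀ k₂ ∈ S, ‖schwartzWeight f ω s u v ε k₁ k₂‖ ≤
      C * ((1 + ‖u‖)⁻¹ ^ P * ((1 + ‖v‖)⁻¹ ^ P * (absMax ε)⁻¹ ^ Q)) := by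
  obtain ⟨C₁, A, hC₁, hω⟩ := norm_quasiChar_le ω
  obtain ⟨C₂, A', _, habs⟩ := norm_absPow_le F (2 * s - 2)
  obtain ⟨C₃, hC₃, hf⟩ := hf.norm_inv_mul_mul_le hS (4 * P + (Q + A + A'))
  refine ⟨C₃ * C₁ * C₂, fun u v ε k₁ hk₁ k₂ hk₂ => ?_⟩
  have hm := absMax_pos ε
  have hfε := (mul_le_mul_of_nonneg_left (gauge_mul_le u v ε P (Q + A + A'))
    (norm_nonneg _)).trans (hf k₁ hk₁ k₂ hk₂ _ _)
  rw [← le_div_iff₀ (by positivity)] at hfε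
  rw [schwartzWeight, norm_mul, norm_mul]
  calc _ ≤ C₃ / ((1 + ‖u‖) ^ P * (1 + ‖v‖) ^ P * absMax ε ^ (Q + A + A')) *
        (C₁ * absMax ε ^ A) * (C₂ * absMax ε ^ A') := by
        gcongr
        exacts [hω ε, habs ε]
    _ = C₃ * C₁ * C₂ * ((1 + ‖u‖)⁻¹ ^ P * ((1 + ‖v‖)⁻¹ ^ P * (absMax ε)⁻¹ ^ Q)) := by
        rw [inv_pow, inv_pow, inv_pow, pow_add, pow_add]
        field_simp

end Bounds

section Measurability

variable {F : Type*} [NontriviallyNormedField F]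

theorem continuous_matrix_fin_two {X R : Type*} [TopologicalSpace X] [TopologicalSpace R]
    {a b c d : X → R} (ha : Continuous a) (hb : Continuous b) (hc : Continuous c)
    (hd : Continuous d) : Continuous fun x => !![a x, b x; c x, d x] :=
  continuous_matrix fun i j => by fin_cases i <;> fin_cases j <;> assumption

theorem continuous_diagOne : Continuous (diagOne : Fˣ → GL (Fin 2) F) :=
  Units.continuous_iff.2
    ⟨continuous_matrix_fin_two Units.continuous_val continuous_const continuous_const
      continuous_const,
    continuous_matrix_fin_two Units.continuous_coe_inv continuous_const continuous_const
      continuous_const⟩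

variable [ProperSpace F]

instance secondCountableTopology_GL : SecondCountableTopology (GL (Fin 2) F) :=
  have : SecondCountableTopology (Matrix (Fin 2) (Fin 2) F) :=
    inferInstanceAs (SecondCountableTopology (Fin 2 → Fin 2 → F))
  have : SecondCountableTopology (Matrix (Fin 2) (Fin 2) F)ᵐᵒᵖ :=
    MulOpposite.opHomeomorph.symm.secondCountableTopology
  Units.isEmbedding_embedProduct.secondCountableTopology

instance secondCountableTopology_subgroup (K : Subgroup (GL (Fin 2) F)) :
    SecondCountableTopology K :=
  IsEmbedding.subtypeVal.secondCountableTopology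

variable [MeasurableSpace F] [BorelSpace F] {K : Subgroup (GL (Fin 2) F)} [MeasurableSpace K]
  [BorelSpace K]

theorem measurable_torusIntegrand {ψ : AddChar F Circle} (hψ : Continuous ψ)
    {W : GL (Fin 2) F → ℂ} (hW : Continuous W) (χ : Fˣ →ₜ* ℂˣ) (s : ℂ) :
    Measurable fun p : K × F × Fˣ => torusIntegrand ψ W χ s p.1 p.2.1 p.2.2 := by
  have hχ : Continuous fun a : Fˣ => (χ a : ℂ) := Units.continuous_val.comp χ.continuous_toFun
  have hcont : Continuous fun p : K × F × Fˣ =>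
      W (diagOne p.2.2 * p.1) * (ψ (p.2.1 * p.2.2) : ℂ) * (χ p.2.2 : ℂ) := by
    have := continuous_diagOne (F := F)
    fun_prop
  exact hcont.measurable.mul ((measurable_absPow _).comp measurable_snd.snd)

theorem measurable_schwartzWeight
    {f : Matrix (Fin 2) (Fin 2) F × Matrix (Fin 2) (Fin 2) F → ℂ} (hf : Continuous f)
    (ω : Fˣ →ₜ* ℂˣ) (s : ℂ) : Measurable fun p : F × F × Fˣ × K × K =>
      schwartzWeight f ω s p.1 p.2.1 p.2.2.1 p.2.2.2.1 p.2.2.2.2 := by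
  have hω : Continuous fun a : Fˣ => (ω a : ℂ) := Units.continuous_val.comp ω.continuous_toFun
  have hinv : Continuous fun p : F × F × Fˣ × K × K => (p.2.2.1 : F)⁻¹ := by
    have h : Continuous fun a : Fˣ => (a : F)⁻¹ :=
      Units.continuous_val.inv₀ fun a => a.ne_zero
    exact h.comp (by fun_prop)
  have hleft : Continuous fun k : K => ((k : GL (Fin 2) F)⁻¹).val :=
    Units.continuous_coe_inv.comp continuous_subtype_val
  have hX : Continuous fun p : F × F × Fˣ × K × K =>
      !![(p.2.2.1 : F)⁻¹, (p.2.2.1 : F)⁻¹ * p.2.1; 0, 0] :=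
    continuous_matrix_fin_two (by fun_prop) (by fun_prop) (by fun_prop) (by fun_prop)
  have hY : Continuous fun p : F × F × Fˣ × K × K =>
      !![0, -p.1 * (p.2.2.1 : F); 0, (p.2.2.1 : F)] :=
    continuous_matrix_fin_two (by fun_prop) (by fun_prop) (by fun_prop) (by fun_prop)
  have hcont : Continuous fun p : F × F × Fˣ × K × K =>
      f (((p.2.2.2.1 : GL (Fin 2) F)⁻¹).val *
          !![(p.2.2.1 : F)⁻¹, (p.2.2.1 : F)⁻¹ * p.2.1; 0, 0] * (p.2.2.2.2 : GL (Fin 2) F).val,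
        ((p.2.2.2.1 : GL (Fin 2) F)⁻¹).val *
          !![0, -p.1 * (p.2.2.1 : F); 0, (p.2.2.1 : F)] * (p.2.2.2.2 : GL (Fin 2) F).val) *
        (ω p.2.2.1 : ℂ) := by
    fun_prop
  exact hcont.measurable.mul ((measurable_absPow _).comp measurable_snd.snd.fst)

end Measurability

section Convergence

variable {F : Type*} [NontriviallyNormedField F] [ProperSpace F] [MeasurableSpace F] [BorelSpace F]
  {K : Subgroup (GL (Fin 2) F)} [MeasurableSpace K] [BorelSpace K]

theorem integrable_torusIntegrand_of_le {dt : Measure Fˣ} {ψ : AddChar F Circle}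
    (hψ : Continuous ψ) {W : GL (Fin 2) F → ℂ} (hW : Continuous W) (χ : Fˣ →ₜ* ℂˣ) (s : ℂ)
    {φ : Fˣ → ℝ} (hφ : Integrable φ dt) {C : ℝ} (k : K) (u : F)
    (hle : ∀ a, ‖torusIntegrand ψ W χ s k u a‖ ≤ C * φ a) :
    Integrable (torusIntegrand ψ W χ s k u) dt :=
  have hslice : Measurable fun a : Fˣ => (k, u, a) := by fun_prop
  (hφ.const_mul C).mono' ((measurable_torusIntegrand hψ hW χ s).comp hslice).aestronglyMeasurable
    (.of_forall hle)

theorem zetaConvergesAbsolutely_of_bounds (dx : Measure F) [dx.IsAddHaarMeasure]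
    (dt : Measure Fˣ) [dt.IsHaarMeasure] (dk : Measure K) [IsFiniteMeasure dk]
    {ψ : AddChar F Circle} (hψ : Continuous ψ) (ω μ : Fˣ →ₜ* ℂˣ) {W₁ W₂ : GL (Fin 2) F → ℂ}
    (hcont₁ : Continuous W₁) (hcont₂ : Continuous W₂)
    {f : Matrix (Fin 2) (Fin 2) F × Matrix (Fin 2) (Fin 2) F → ℂ} (hf : Continuous f)
    {s₁ s₂ : ℂ} {Φ : F → ℝ} {φ : Fˣ → ℝ} (hΦ : Integrable Φ dx) (hφ : Integrable φ dt)
    {C C₁ C₂ : ℝ}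
    (hweight : ∀ (u v : F) (ε : Fˣ) (k₁ k₂ : K),
      ‖schwartzWeight f ω s₂ u v ε k₁ k₂‖ ≤ C * (Φ u * (Φ v * φ ε)))
    (htorus₁ : ∀ (k : K) (u : F) (a : Fˣ), ‖torusIntegrand ψ W₁ μ s₁ k u a‖ ≤ C₁ * φ a)
    (htorus₂ : ∀ (k : K) (u : F) (a : Fˣ), ‖torusIntegrand ψ W₂ μ⁻¹ s₂ k u a‖ ≤ C₂ * φ a) :
    ZetaConvergesAbsolutely dx dt dk ψ ω μ W₁ W₂ f s₁ s₂ := by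
  have hmeas₁ := measurable_torusIntegrand (K := K) hψ hcont₁ μ s₁
  have hmeas₂ := measurable_torusIntegrand (K := K) hψ hcont₂ μ⁻¹ s₂
  have hfull : Integrable (fullIntegrand ψ ω μ W₁ W₂ f s₁ s₂)
      ((outerMeasure dx dt dk).prod (dt.prod dt)) := by
    have hdom := ((hΦ.mul_prod (hΦ.mul_prod (hφ.mul_prod
      (integrable_const (μ := dk.prod dk) C)))).mul_prod
        ((hφ.const_mul C₁).mul_prod (hφ.const_mul C₂)))
    refine hdom.mono' ?_ (.of_forall fun q => ?_)
    · have hkuα : Measurable fun q : (F × F × Fˣ × K × K) × (Fˣ × Fˣ) =>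
          (q.1.2.2.2.1, q.1.1, q.2.1) := by fun_prop
      have hkvβ : Measurable fun q : (F × F × Fˣ × K × K) × (Fˣ × Fˣ) =>
          (q.1.2.2.2.2, q.1.2.1, q.2.2) := by fun_prop
      exact ((((measurable_schwartzWeight hf ω s₂).comp measurable_fst).mul
        (hmeas₁.comp hkuα)).mul (hmeas₂.comp hkvβ)).aestronglyMeasurable
    · rw [fullIntegrand, norm_mul, norm_mul]
      have hw := hweight q.1.1 q.1.2.1 q.1.2.2.1 q.1.2.2.2.1 q.1.2.2.2.2
      have h₁ := htorus₁ q.1.2.2.2.1 q.1.1 q.2.1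
      calc _ ≤ _ := mul_le_mul (mul_le_mul hw h₁ (norm_nonneg _) ((norm_nonneg _).trans hw))
            (htorus₂ q.1.2.2.2.2 q.1.2.1 q.2.2) (norm_nonneg _)
            (mul_nonneg ((norm_nonneg _).trans hw) ((norm_nonneg _).trans h₁))
        _ = _ := by ring
  have houter : Integrable (outerIntegrand dt ψ ω μ W₁ W₂ f s₁ s₂) (outerMeasure dx dt dk) := by
    refine hfull.integral_prod_left.congr (.of_forall fun p => ?_)
    simp only [fullIntegrand, outerIntegrand, mul_assoc, integral_const_mul]
    rw [integral_prod_mul]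
  exact ⟨fun k u => integrable_torusIntegrand_of_le hψ hcont₁ μ s₁ hφ k u (htorus₁ k u),
    fun k v => integrable_torusIntegrand_of_le hψ hcont₂ μ⁻¹ s₂ hφ k v (htorus₂ k v),
    houter, hfull⟩

variable [CompactSpace K]

theorem exists_zetaConvergesAbsolutely (dx : Measure F) [dx.IsAddHaarMeasure]
    (dt : Measure Fˣ) [dt.IsHaarMeasure] (dk : Measure K) [IsFiniteMeasure dk]
    {ψ : AddChar F Circle} (hψ : Continuous ψ) (ω μ : Fˣ →ₜ* ℂˣ) {W₁ W₂ : GL (Fin 2) F → ℂ}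
    (hcont₁ : Continuous W₁) (hcont₂ : Continuous W₂) (hW₁ : HasTorusDecay K W₁)
    (hW₂ : HasTorusDecay K W₂) :
    ∃ c : ℝ, ∀ f : Matrix (Fin 2) (Fin 2) F × Matrix (Fin 2) (Fin 2) F → ℂ,
      Continuous f → IsRapidlyDecreasing f → ∀ s₁ s₂ : ℂ, c < s₁.re → c < s₂.re →
        ZetaConvergesAbsolutely dx dt dk ψ ω μ W₁ W₂ f s₁ s₂ := by
  obtain ⟨P, hP⟩ := exists_integrable_inv_one_add_norm_pow dx
  obtain ⟨Q, hQ⟩ := exists_integrable_inv_absMax_pow dt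
  obtain ⟨c₁, hc₁⟩ := hW₁.norm_torusIntegrand_le ψ μ Q
  obtain ⟨c₂, hc₂⟩ := hW₂.norm_torusIntegrand_le ψ μ⁻¹ Q
  refine ⟨max c₁ c₂, fun f hfcont hf s₁ s₂ hs₁ hs₂ => ?_⟩
  obtain ⟨C, hC⟩ := hf.norm_schwartzWeight_le (isCompact_iff_compactSpace.2 ‹_›) ω s₂ P Q
  obtain ⟨C₁, hC₁⟩ := hc₁ s₁ ((le_max_left _ _).trans_lt hs₁)
  obtain ⟨C₂, hC₂⟩ := hc₂ s₂ ((le_max_right _ _).trans_lt hs₂)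
  exact zetaConvergesAbsolutely_of_bounds dx dt dk hψ ω μ hcont₁ hcont₂ hfcont hP hQ
    (fun u v ε k₁ k₂ => hC u v ε k₁ k₁.2 k₂ k₂.2) (fun k => hC₁ k k.2) (fun k => hC₂ k k.2)

end Convergence

section Matrices

variable {F : Type*} [Field F]

theorem diagOne_mul (a b : Fˣ) : diagOne (a * b) = diagOne a * diagOne b := by
  ext i j
  fin_cases i <;> fin_cases j <;> simp [diagOne]

theorem diagOne_mul_unip (a : Fˣ) (x : F) : diagOne a * unip x = unip (a * x) * diagOne a := by
  ext i j
  fin_cases i <;> fin_cases j <;>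
    simp [diagOne, unip, GeneralLinearGroup.upperRightHom, Matrix.mul_apply]

theorem unip_inv (x : F) : (unip x)⁻¹ = unip (-x) := by
  rw [inv_eq_iff_mul_eq_one]
  ext i j
  fin_cases i <;> fin_cases j <;> simp [unip, GeneralLinearGroup.upperRightHom, Matrix.mul_apply]

theorem diagOne_inv_mul_mul_diagOne (a : Fˣ) (X : Matrix (Fin 2) (Fin 2) F) :
    ((diagOne a)⁻¹).val * X * (diagOne a).val =
      !![X 0 0, (a : F)⁻¹ * X 0 1; (a : F) * X 1 0, X 1 1] := by
  rw [show ((diagOne a)⁻¹).val = !![((a⁻¹ : Fˣ) : F), 0; 0, 1] from rfl, X.eta_fin_two]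
  simp [diagOne, mul_comm]

theorem inv_apply_zero_one_eq_zero {g : GL (Fin 2) F} (hg : g.val 0 1 = 0) :
    (g⁻¹).val 0 1 = 0 := by
  simp [Matrix.coe_units_inv, Matrix.inv_def, Matrix.adjugate_fin_two, hg]

end Matrices

section Compactness

variable {F : Type*} [NontriviallyNormedField F] [ProperSpace F]

theorem isCompact_setOf_norm_le_GL (R : ℝ) :
    IsCompact {g : GL (Fin 2) F | ‖g.val‖ ≤ R ∧ ‖(g⁻¹).val‖ ≤ R} := by
  have hball : IsCompact (Metric.closedBall (0 : Matrix (Fin 2) (Fin 2) F) R) :=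
    have : ProperSpace (Matrix (Fin 2) (Fin 2) F) := inferInstanceAs (ProperSpace (_ → _ → F))
    isCompact_closedBall 0 R
  convert Units.isClosedEmbedding_embedProduct.isCompact_preimage
    (hball.prod (MulOpposite.opHomeomorph.isCompact_image.2 hball)) using 1
  ext g
  simp [Units.embedProduct, -Matrix.coe_units_inv]

end Compactness

section Congruence

variable {F : Type*} [NontriviallyNormedField F]

theorem norm_diagOne_inv_mul_mul_le {X : Matrix (Fin 2) (Fin 2) F} (hX : X 0 1 = 0) {a : Fˣ}
    (ha : ‖(a : F)‖ ≤ 1) : ‖((diagOne a)⁻¹).val * X * (diagOne a).val‖ ≤ ‖X‖ := by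
  have hle : ∀ i j, ‖X i j‖ ≤ ‖X‖ := fun i j => Matrix.norm_entry_le_entrywise_sup_norm X
  rw [diagOne_inv_mul_mul_diagOne, Matrix.norm_le_iff (norm_nonneg X)]
  intro i j
  fin_cases i <;> fin_cases j
  · exact hle 0 0
  · simp [hX]
  · exact (norm_mul_le _ _).trans ((mul_le_of_le_one_left (norm_nonneg _) ha).trans (hle 1 0))
  · exact hle 1 1

variable [IsUltrametricDist F]

instance isUltrametricDist_matrix : IsUltrametricDist (Matrix (Fin 2) (Fin 2) F) :=
  inferInstanceAs (IsUltrametricDist (Fin 2 → Fin 2 → F))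

theorem norm_mul_le_of_isUltrametricDist (X Y : Matrix (Fin 2) (Fin 2) F) :
    ‖X * Y‖ ≤ ‖X‖ * ‖Y‖ := by
  refine (Matrix.norm_le_iff (by positivity)).2 fun i j => ?_
  rw [Matrix.mul_apply]
  refine IsUltrametricDist.norm_sum_le_of_forall_le_of_nonneg (by positivity) fun l _ => ?_
  rw [norm_mul]
  exact mul_le_mul (Matrix.norm_entry_le_entrywise_sup_norm X)
    (Matrix.norm_entry_le_entrywise_sup_norm Y) (norm_nonneg _) (norm_nonneg _)

theorem mem_integralGL_iff {g : GL (Fin 2) F} :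
    g ∈ integralGL F ↔ ‖g.val‖ ≤ 1 ∧ ‖(g⁻¹).val‖ ≤ 1 := by
  rw [Matrix.norm_le_iff zero_le_one, Matrix.norm_le_iff zero_le_one]
  rfl

variable (F) in
/-- The congruence subgroup of `GL₂(𝒪)` of level `r`: the integral matrices at distance at most `r`
from the identity. -/
def congruenceGL (r : ℝ≥0) : Subgroup (GL (Fin 2) F) where
  carrier := {g | g ∈ integralGL F ∧ ‖g.val - 1‖ ≤ r}
  one_mem' := ⟨one_mem _, by simp⟩
  mul_mem' := by
    rintro g h ⟨hg, hg'⟩ ⟨hh, hh'⟩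
    refine ⟨mul_mem hg hh, ?_⟩
    have hsub : (g * h).val - 1 = (g.val - 1) * h.val + (h.val - 1) := by
      rw [Units.val_mul]; noncomm_ring
    have hmul := (norm_mul_le_of_isUltrametricDist (g.val - 1) h.val).trans
      (mul_le_of_le_one_right (norm_nonneg _) (mem_integralGL_iff.1 hh).1)
    rw [hsub]
    exact (IsUltrametricDist.norm_add_le_max _ _).trans (max_le (hmul.trans hg') hh')
  inv_mem' := by
    rintro g ⟨hg, hg'⟩
    refine ⟨inv_mem hg, ?_⟩
    have hsub : (g⁻¹).val - 1 = -((g⁻¹).val * (g.val - 1)) := by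
      rw [mul_sub, Units.inv_mul]; noncomm_ring
    rw [hsub, norm_neg]
    exact (norm_mul_le_of_isUltrametricDist _ _).trans
      ((mul_le_of_le_one_left (norm_nonneg _) (mem_integralGL_iff.1 hg).2).trans hg')

theorem exists_congruenceGL_subset {U : Set (GL (Fin 2) F)} (hU : U ∈ 𝓝 1) :
    ∃ r : ℝ≥0, 0 < r ∧ r < 1 ∧ (congruenceGL F r : Set (GL (Fin 2) F)) ⊆ U := by
  rw [Units.isEmbedding_embedProduct.nhds_eq_comap, mem_comap] at hU
  obtain ⟨T, hT, hTU⟩ := hU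
  obtain ⟨A, hA, B, hB, hAB⟩ := mem_nhds_prod_iff.1 hT
  have hAB' : A ∩ MulOpposite.op ⁻¹' B ∈ 𝓝 (1 : Matrix (Fin 2) (Fin 2) F) :=
    inter_mem hA (MulOpposite.continuous_op.continuousAt.preimage_mem_nhds hB)
  obtain ⟨s, hs, hball⟩ := Metric.nhds_basis_closedBall.mem_iff.1 hAB'
  have hr : (0 : ℝ) < min s (1 / 2) := by positivity
  refine ⟨⟨min s (1 / 2), hr.le⟩, hr, (min_le_right s (1 / 2)).trans_lt (by norm_num), ?_⟩
  have hmem : ∀ g ∈ congruenceGL F ⟨min s (1 / 2), hr.le⟩, g.val ∈ A ∩ MulOpposite.op ⁻¹' B :=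
    fun g hg => hball (mem_closedBall_iff_norm.2 (hg.2.trans (min_le_left _ _)))
  exact fun g hg => hTU (hAB ⟨(hmem g hg).1, (hmem g⁻¹ (inv_mem hg)).2⟩)

theorem isOpen_congruenceGL {r : ℝ≥0} (hr : 0 < r) :
    IsOpen (congruenceGL F r : Set (GL (Fin 2) F)) := by
  refine Subgroup.isOpen_of_mem_nhds (g := 1) _ ?_
  have hle : ∀ s : ℝ, 0 < s → ∀ᶠ g : GL (Fin 2) F in 𝓝 1, ‖g.val - 1‖ ≤ s := fun s hs => by
    have hcont : Continuous fun g : GL (Fin 2) F => ‖g.val - 1‖ :=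
      (Units.continuous_val.sub continuous_const).norm
    exact (hcont.tendsto 1).eventually_le_const (by simpa using hs)
  have hintegral : ∀ X : Matrix (Fin 2) (Fin 2) F, ‖X - 1‖ ≤ 1 → ‖X‖ ≤ 1 := fun X hX => by
    simpa using (IsUltrametricDist.norm_add_le_max (X - 1) 1).trans (max_le hX (by simp))
  have hinv : Tendsto (fun g : GL (Fin 2) F => g⁻¹) (𝓝 1) (𝓝 1) := by
    simpa using (continuous_inv (G := GL (Fin 2) F)).tendsto 1
  filter_upwards [hle 1 one_pos, hinv.eventually (hle 1 one_pos), hle r hr] with g hg hg' hgr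
  exact ⟨mem_integralGL_iff.2 ⟨hintegral _ hg, hintegral _ hg'⟩, hgr⟩

theorem unip_mem_congruenceGL {r : ℝ≥0} (hr : r ≤ 1) {x : F} (hx : ‖x‖ ≤ r) :
    unip x ∈ congruenceGL F r := by
  have hval : ∀ y : F, (unip y).val = !![1, y; 0, 1] := fun y => rfl
  have hnorm : ∀ y : F, ‖y‖ ≤ 1 → ‖(unip y).val‖ ≤ 1 := fun y hy => by
    rw [hval, Matrix.norm_le_iff zero_le_one]
    intro i j
    fin_cases i <;> fin_cases j <;> simp [hy]
  have hx1 : ‖x‖ ≤ 1 := hx.trans hr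
  refine ⟨mem_integralGL_iff.2 ⟨hnorm x hx1, unip_inv x ▸ hnorm (-x) (by rwa [norm_neg])⟩, ?_⟩
  rw [hval]
  refine (Matrix.norm_le_iff r.2).2 fun i j => ?_
  fin_cases i <;> fin_cases j <;> simp [hx]

theorem conj_diagOne_mem_congruenceGL {r : ℝ≥0} {g : GL (Fin 2) F} (hg : g ∈ congruenceGL F r)
    (hlower : g.val 0 1 = 0) {a : Fˣ} (ha : ‖(a : F)‖ ≤ 1) :
    (diagOne a)⁻¹ * g * diagOne a ∈ congruenceGL F r := by
  have hinv : ((diagOne a)⁻¹ * g * diagOne a)⁻¹ = (diagOne a)⁻¹ * g⁻¹ * diagOne a := by group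
  have hsub : ((diagOne a)⁻¹ * g * diagOne a).val - 1 =
      ((diagOne a)⁻¹).val * (g.val - 1) * (diagOne a).val := by
    rw [mul_sub, sub_mul, mul_one, Units.inv_mul, Units.val_mul, Units.val_mul]
  obtain ⟨hg1, hg1'⟩ := mem_integralGL_iff.1 hg.1
  refine ⟨mem_integralGL_iff.2 ⟨?_, ?_⟩, ?_⟩
  · exact (norm_diagOne_inv_mul_mul_le hlower ha).trans hg1
  · rw [hinv]
    exact (norm_diagOne_inv_mul_mul_le (inv_apply_zero_one_eq_zero hlower) ha).trans hg1'
  · rw [hsub]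
    exact (norm_diagOne_inv_mul_mul_le (by simpa using hlower) ha).trans hg.2

theorem exists_eq_unip_mul_of_mem_congruenceGL {r : ℝ≥0} (hr : r < 1) {g : GL (Fin 2) F}
    (hg : g ∈ congruenceGL F r) :
    ∃ x : F, ‖x‖ ≤ r ∧ ∃ h ∈ congruenceGL F r, h.val 0 1 = 0 ∧ g = unip x * h := by
  have hentry : ∀ i j, ‖(g.val - 1) i j‖ ≤ r := fun i j =>
    (Matrix.norm_entry_le_entrywise_sup_norm _).trans hg.2
  have hd : ‖g.val 1 1‖ = 1 := by
    have hlt : ‖g.val 1 1 - 1‖ < 1 := (by simpa using hentry 1 1 : _ ≤ (r : ℝ)).trans_lt hr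
    have h := IsUltrametricDist.norm_eq_of_add_norm_lt_max (x := g.val 1 1) (y := -1)
      (by simpa [← sub_eq_add_neg] using Or.inr hlt)
    simpa using h
  have hd0 : g.val 1 1 ≠ 0 := norm_ne_zero_iff.1 (hd ▸ one_ne_zero)
  have hx : ‖g.val 0 1 / g.val 1 1‖ ≤ r := by
    rw [norm_div, hd, div_one]
    simpa using hentry 0 1
  refine ⟨g.val 0 1 / g.val 1 1, hx, (unip (g.val 0 1 / g.val 1 1))⁻¹ * g,
    mul_mem (inv_mem (unip_mem_congruenceGL hr.le hx)) hg, ?_, (mul_inv_cancel_left _ _).symm⟩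
  rw [unip_inv, Units.val_mul, Matrix.mul_apply, Fin.sum_univ_two]
  simp [unip, GeneralLinearGroup.upperRightHom, hd0]

variable [ProperSpace F]

instance compactSpace_integralGL : CompactSpace (integralGL F) := by
  refine isCompact_iff_compactSpace.1 ?_
  convert isCompact_setOf_norm_le_GL (F := F) 1 using 1
  ext g
  exact mem_integralGL_iff

theorem isCompact_congruenceGL {r : ℝ≥0} (hr : 0 < r) :
    IsCompact (congruenceGL F r : Set (GL (Fin 2) F)) :=
  (isCompact_iff_compactSpace.2 (compactSpace_integralGL (F := F))).of_isClosed_subset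
    (Subgroup.isClosed_of_isOpen _ (isOpen_congruenceGL hr)) fun _ hg => hg.1

end Congruence

section Recurrence

theorem norm_le_mul_pow_of_recurrence {R : Type*} [SeminormedRing R] {b : ℕ → R} {D n₀ : ℕ}
    {c : Fin D → R} {S : ℝ} (hS : 0 ≤ S) (hinit : ∀ n < n₀ + D, ‖b n‖ ≤ S)
    (hrec : ∀ n ≥ n₀, b (n + D) = ∑ i : Fin D, c i * b (n + i)) (n : ℕ) :
    ‖b n‖ ≤ S * (1 + ∑ i, ‖c i‖) ^ n := by
  set T : ℝ := 1 + ∑ i, ‖c i‖ with hT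
  have hT1 : 1 ≤ T := le_add_of_nonneg_right (by positivity)
  induction n using Nat.strong_induction_on with
  | _ n ih =>
    rcases lt_or_ge n (n₀ + D) with hn | hn
    · exact (hinit n hn).trans (le_mul_of_one_le_right hS (one_le_pow₀ hT1))
    obtain ⟨m, rfl⟩ : ∃ m, n = m + D := ⟨n - D, by omega⟩
    have hterm : ∀ i : Fin D, ‖c i * b (m + i)‖ ≤ ‖c i‖ * (S * T ^ (m + D - 1)) := fun i => by
      have hi := i.2
      refine (norm_mul_le _ _).trans ?_
      gcongr
      exact (ih (m + i) (by omega)).trans (by gcongr; omega)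
    rw [hrec m (by omega)]
    rcases Nat.eq_zero_or_pos D with rfl | hD
    · simp only [Finset.univ_eq_empty, Finset.sum_empty, norm_zero]
      positivity
    calc ‖∑ i : Fin D, c i * b (m + i)‖ ≤ ∑ i : Fin D, ‖c i‖ * (S * T ^ (m + D - 1)) :=
          (norm_sum_le _ _).trans (Finset.sum_le_sum fun i _ => hterm i)
      _ = (∑ i, ‖c i‖) * (S * T ^ (m + D - 1)) := by rw [Finset.sum_mul]
      _ ≤ T * (S * T ^ (m + D - 1)) := by
        gcongr
        exact le_add_of_nonneg_left zero_le_one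
      _ = S * T ^ (m + D) := by rw [mul_left_comm, ← pow_succ', Nat.sub_add_cancel (by omega)]

theorem exists_eq_sum_smul_of_isNoetherian {R V : Type*} [Ring R] [AddCommGroup V] [Module R V]
    [IsNoetherian R V] (u : ℕ → V) : ∃ (D : ℕ) (c : Fin D → R), u D = ∑ i, c i • u i := by
  have hmono : Monotone fun n => Submodule.span R (Set.range fun i : Fin n => u i) := by
    refine fun m n hmn => Submodule.span_mono ?_
    rintro _ ⟨i, rfl⟩
    exact ⟨Fin.castLE hmn i, rfl⟩
  obtain ⟨D, hD⟩ := monotone_stabilizes_iff_noetherian.2 ‹_› ⟨_, hmono⟩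
  have hmem : u D ∈ Submodule.span R (Set.range fun i : Fin (D + 1) => u i) :=
    Submodule.subset_span ⟨Fin.last D, rfl⟩
  have hstable : Submodule.span R (Set.range fun i : Fin D => u i) =
      Submodule.span R (Set.range fun i : Fin (D + 1) => u i) := hD (D + 1) D.le_succ
  obtain ⟨c, hc⟩ := (Submodule.mem_span_range_iff_exists_fun R).1 (hstable ▸ hmem)
  exact ⟨D, c, hc.symm⟩

end Recurrence

section Characters

theorem eq_one_of_forall_norm_pow_two_pow_sub_one_lt {z : ℂ}
    (hz : ∀ n : ℕ, ‖z ^ 2 ^ n - 1‖ < 1 / 2) : z = 1 := by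
  have hstep : ∀ w : ℂ, ‖w - 1‖ < 1 / 2 → 3 / 2 * ‖w - 1‖ ≤ ‖w ^ 2 - 1‖ := fun w hw => by
    have htri := norm_sub_le (w + 1) (w - 1)
    rw [show w + 1 - (w - 1) = 2 by ring, Complex.norm_ofNat] at htri
    rw [show w ^ 2 - 1 = (w + 1) * (w - 1) by ring, norm_mul]
    gcongr
    linarith
  have hgrow : ∀ n : ℕ, (3 / 2 : ℝ) ^ n * ‖z - 1‖ ≤ ‖z ^ 2 ^ n - 1‖ := by
    intro n
    induction n with
    | zero => simp
    | succ n ih =>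
      calc (3 / 2 : ℝ) ^ (n + 1) * ‖z - 1‖ = 3 / 2 * ((3 / 2 : ℝ) ^ n * ‖z - 1‖) := by ring
        _ ≤ 3 / 2 * ‖z ^ 2 ^ n - 1‖ := by gcongr
        _ ≤ ‖z ^ 2 ^ (n + 1) - 1‖ := by
          simpa only [← pow_mul, ← pow_succ] using hstep _ (hz n)
  by_contra hne
  have hpos : 0 < ‖z - 1‖ := norm_pos_iff.2 (sub_ne_zero.2 hne)
  obtain ⟨n, hn⟩ := pow_unbounded_of_one_lt (1 / ‖z - 1‖) (by norm_num : (1 : ℝ) < 3 / 2)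
  rw [div_lt_iff₀ hpos] at hn
  linarith [(hgrow n).trans_lt (hz n)]

theorem exists_forall_norm_le_addChar_eq_one {E : Type*} [SeminormedAddCommGroup E]
    [IsUltrametricDist E] {ψ : AddChar E Circle} (hψ : Continuous ψ) :
    ∃ δ > 0, ∀ x : E, ‖x‖ ≤ δ → ψ x = 1 := by
  have hcont : Continuous fun x : E => ‖(ψ x : ℂ) - 1‖ :=
    ((continuous_subtype_val.comp hψ).sub continuous_const).norm
  have hnhds : ∀ᶠ x : E in 𝓝 0, ‖(ψ x : ℂ) - 1‖ < 1 / 2 :=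
    (hcont.tendsto 0).eventually_lt_const (by simp)
  obtain ⟨δ, hδ, hball⟩ := Metric.nhds_basis_closedBall.mem_iff.1 hnhds
  refine ⟨δ, hδ, fun x hx => Circle.ext (eq_one_of_forall_norm_pow_two_pow_sub_one_lt fun n => ?_)⟩
  have hmem : ‖2 ^ n • x‖ ≤ δ := (IsUltrametricDist.norm_nsmul_le x _).trans hx
  have hlt : ‖(ψ (2 ^ n • x) : ℂ) - 1‖ < 1 / 2 := hball (mem_closedBall_zero_iff.2 hmem)
  rwa [AddChar.map_nsmul_eq_pow, Circle.coe_pow] at hlt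

end Characters

section SmoothRepresentations

variable {k G V : Type*} [Group G] [AddCommGroup V]

theorem isLocallyConstant_apply_of_isOpen [CommSemiring k] [Module k V] [TopologicalSpace G]
    [ContinuousMul G] {ρ : Representation k G V} {v : V} (hv : IsOpen {g | ρ g v = v}) :
    IsLocallyConstant fun g => ρ g v := by
  rw [IsLocallyConstant.iff_isOpen_fiber_apply]
  intro g
  have hfiber : (fun h => ρ h v) ⁻¹' {ρ g v} = (fun h => g⁻¹ * h) ⁻¹' {h | ρ h v = v} := by
    ext h
    simp only [Set.mem_preimage, Set.mem_singleton_iff, Set.mem_ofPred_eq, map_mul,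
      Module.End.mul_apply]
    exact ⟨fun e => by rw [e, ρ.inv_self_apply], fun e => by rw [← ρ.self_inv_apply g (ρ h v), e]⟩
  rw [hfiber]
  exact hv.preimage (continuous_const_mul _)

theorem finite_image_of_isLocallyConstant {X Y : Type*} [TopologicalSpace X] {f : X → Y}
    (hf : IsLocallyConstant f) {S : Set X} (hS : IsCompact S) : (f '' S).Finite := by
  have := isCompact_iff_compactSpace.1 hS
  rw [Set.image_eq_range]
  exact (hf.comp_continuous continuous_subtype_val).range_finite

theorem exists_mem_invariants_of_finite_orbit [Field k] [CharZero k] [Module k V]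
    {ρ : Representation k G V} {v : V} (hv : (Set.range fun g => ρ g v).Finite) :
    ∃ u ∈ ρ.invariants, ∀ L : V →ₗ[k] k, (∀ g, L (ρ g v) = L v) → L u = L v := by
  classical
  set O : Finset V := hv.toFinset
  have hmem : ∀ x, x ∈ O ↔ ∃ g, ρ g v = x := fun x => hv.mem_toFinset
  have hcard : (O.card : k) ≠ 0 := Nat.cast_ne_zero.2
    (Finset.card_pos.2 ⟨v, (hmem v).2 ⟨1, by simp⟩⟩).ne'
  have hinj : ∀ g, Function.Injective (ρ g) := fun g =>
    Function.LeftInverse.injective (ρ.inv_self_apply g)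
  have himage : ∀ g, O.image (ρ g) = O := fun g => by
    refine Finset.eq_of_subset_of_card_le (fun y hy => ?_)
      (Finset.card_image_of_injective O (hinj g)).ge
    obtain ⟨x, hx, rfl⟩ := Finset.mem_image.1 hy
    obtain ⟨h, rfl⟩ := (hmem x).1 hx
    exact (hmem _).2 ⟨g * h, by rw [map_mul, Module.End.mul_apply]⟩
  refine ⟨(O.card : k)⁻¹ • ∑ x ∈ O, x, fun g => ?_, fun L hL => ?_⟩
  · have hsum := Finset.sum_image (f := fun x => x) (hinj g).injOn (s := O)
    rw [himage] at hsum
    rw [map_smul, map_sum, ← hsum]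
  · have hconst : ∀ x ∈ O, L x = L v := fun x hx => by
      obtain ⟨g, rfl⟩ := (hmem x).1 hx
      exact hL g
    rw [map_smul, map_sum, Finset.sum_congr rfl hconst, Finset.sum_const, nsmul_eq_mul,
      smul_eq_mul, inv_mul_cancel_left₀ hcard]

end SmoothRepresentations

section Whittaker

theorem continuous_of_mem_whittakerNA {F : Type*} [NontriviallyNormedField F] {V : Type*}
    [AddCommGroup V] [Module ℂ V] {π : Representation ℂ (GL (Fin 2) F) V} {ψ : AddChar F Circle}
    (hπ : IsAdmissibleNA π) {W : GL (Fin 2) F → ℂ}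
    (hW : W ∈ whittakerNA π ψ) : Continuous W := by
  obtain ⟨ℓ, -, v, rfl⟩ := hW
  exact ((isLocallyConstant_apply_of_isOpen (hπ.smooth v)).comp ℓ).continuous

theorem IsWhittakerFunctional.apply_diagOne_unip {F V : Type*} [Field F] [AddCommGroup V]
    [Module ℂ V] {π : Representation ℂ (GL (Fin 2) F) V} {ψ : AddChar F Circle} {ℓ : V →ₗ[ℂ] ℂ}
    (hℓ : IsWhittakerFunctional π ψ ℓ) (a : Fˣ) (x : F) (v : V) :
    ℓ (π (diagOne a) (π (unip x) v)) = ψ (a * x) * ℓ (π (diagOne a) v) := by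
  rw [← Module.End.mul_apply, ← map_mul, diagOne_mul_unip, map_mul, Module.End.mul_apply, hℓ]

variable {F : Type*} [NontriviallyNormedField F] [IsUltrametricDist F]
variable {V : Type*} [AddCommGroup V] [Module ℂ V] {π : Representation ℂ (GL (Fin 2) F) V}
  {ψ : AddChar F Circle} {ℓ : V →ₗ[ℂ] ℂ}

theorem exists_whittaker_diagOne_eq_zero (hψ : ψ ≠ 1) (hℓ : IsWhittakerFunctional π ψ ℓ) {v : V}
    (hv : IsOpen {g : GL (Fin 2) F | π g v = v}) :
    ∃ R : ℝ, ∀ a : Fˣ, R ≤ ‖(a : F)‖ → ℓ (π (diagOne a) v) = 0 := by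
  obtain ⟨x₀, hx₀⟩ := AddChar.ne_one_iff.1 hψ
  obtain ⟨r, hr0, hr1, hr⟩ := exists_congruenceGL_subset (hv.mem_nhds (by simp : π 1 v = v))
  refine ⟨‖x₀‖ / r, fun a ha => ?_⟩
  have hsmall : ‖x₀ / (a : F)‖ ≤ r := by
    rw [norm_div, div_le_iff₀ (norm_unit_pos a)]
    rwa [div_le_iff₀' (NNReal.coe_pos.2 hr0)] at ha
  have hfix : π (unip (x₀ / (a : F))) v = v := hr (unip_mem_congruenceGL hr1.le hsmall)
  have hequiv := hℓ.apply_diagOne_unip a (x₀ / a) v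
  rw [hfix, mul_div_cancel₀ _ a.ne_zero] at hequiv
  by_contra h0
  exact hx₀ (Circle.ext (right_eq_mul₀ h0 |>.1 hequiv))

theorem whittaker_diagOne_congruenceGL_diagOne {δ : ℝ} (hδ : ∀ x : F, ‖x‖ ≤ δ → ψ x = 1)
    (hℓ : IsWhittakerFunctional π ψ ℓ) {r : ℝ≥0} (hr : r < 1) {v : V}
    (hv : ∀ g ∈ congruenceGL F r, π g v = v) {a b : Fˣ} (ha : ‖(a : F)‖ ≤ δ) (hb : ‖(b : F)‖ ≤ 1)
    {g : GL (Fin 2) F} (hg : g ∈ congruenceGL F r) :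
    ℓ (π (diagOne a) (π g (π (diagOne b) v))) = ℓ (π (diagOne a) (π (diagOne b) v)) := by
  obtain ⟨x, hx, h, hh, hlower, rfl⟩ := exists_eq_unip_mul_of_mem_congruenceGL hr hg
  have hfix : π h (π (diagOne b) v) = π (diagOne b) v := by
    have hconj : h * diagOne b = diagOne b * ((diagOne b)⁻¹ * h * diagOne b) := by group
    rw [← Module.End.mul_apply, ← map_mul, hconj, map_mul, Module.End.mul_apply,
      hv _ (conj_diagOne_mem_congruenceGL hh hlower hb)]
  have hax : ‖(a : F) * x‖ ≤ δ := by
    rw [norm_mul]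
    exact (mul_le_of_le_one_right (norm_nonneg _) (hx.trans hr.le)).trans ha
  rw [map_mul, Module.End.mul_apply, hfix, hℓ.apply_diagOne_unip, hδ _ hax, Circle.coe_one, one_mul]

variable [ProperSpace F]

theorem exists_whittaker_diagOne_recurrence (hπ : IsAdmissibleNA π) (hψ : Continuous ψ)
    (hℓ : IsWhittakerFunctional π ψ ℓ) {p : Fˣ} (hp : ‖(p : F)‖ ≤ 1) (v : V) :
    ∃ (D : ℕ) (c : Fin D → ℂ) (δ : ℝ), 0 < δ ∧ ∀ a : Fˣ, ‖(a : F)‖ ≤ δ →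
      ℓ (π (diagOne (a * p ^ D)) v) = ∑ i, c i * ℓ (π (diagOne (a * p ^ (i : ℕ))) v) := by
  obtain ⟨r, hr0, hr1, hr⟩ :=
    exists_congruenceGL_subset ((hπ.smooth v).mem_nhds (by simp : π 1 v = v))
  obtain ⟨δ, hδ0, hδ⟩ := exists_forall_norm_le_addChar_eq_one hψ
  set Γ := congruenceGL F r
  let ρ : Representation ℂ Γ V := π.comp Γ.subtype
  have : FiniteDimensional ℂ ρ.invariants :=
    hπ.finite Γ (isOpen_congruenceGL hr0)
  have : CompactSpace Γ := isCompact_iff_compactSpace.1 (isCompact_congruenceGL hr0)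
  have hfinite : ∀ w : V, (Set.range fun g => ρ g w).Finite := fun w =>
    ((isLocallyConstant_apply_of_isOpen (hπ.smooth w)).comp_continuous
      continuous_subtype_val).range_finite
  choose u hu hLu using fun n : ℕ =>
    exists_mem_invariants_of_finite_orbit (hfinite (π (diagOne (p ^ n)) v))
  have hvalue : ∀ n, ∀ a : Fˣ, ‖(a : F)‖ ≤ δ →
      ℓ (π (diagOne a) (u n)) = ℓ (π (diagOne (a * p ^ n)) v) := fun n a ha => by
    have hpn : ‖((p ^ n : Fˣ) : F)‖ ≤ 1 := by
      rw [Units.val_pow_eq_pow_val, norm_pow]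
      exact pow_le_one₀ (norm_nonneg _) hp
    rw [diagOne_mul, map_mul, Module.End.mul_apply]
    exact hLu n (ℓ ∘ₗ π (diagOne a)) fun g =>
      whittaker_diagOne_congruenceGL_diagOne hδ hℓ hr1 (fun _ h => hr h) ha hpn g.2
  obtain ⟨D, c, hc⟩ := exists_eq_sum_smul_of_isNoetherian (R := ℂ)
    fun n => (⟨u n, hu n⟩ : ρ.invariants)
  refine ⟨D, c, δ, hδ0, fun a ha => ?_⟩
  have hcV : u D = ∑ i, c i • u i := by simpa using congrArg Subtype.val hc
  rw [← hvalue D a ha, hcV]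
  simp only [map_sum, map_smul, smul_eq_mul, hvalue _ a ha]

end Whittaker

section Decay

variable {F : Type*} [NontriviallyNormedField F]

theorem exists_eq_mul_pow {q : Fˣ} (hq : ‖(q : F)‖ < 1) {a : Fˣ} (ha : ‖(a : F)‖ ≤ 1) :
    ∃ (u : Fˣ) (n : ℕ), ‖(q : F)‖ ≤ ‖(u : F)‖ ∧ ‖(u : F)‖ ≤ 1 ∧ a = u * q ^ n := by
  obtain ⟨n, hlt, hle⟩ := exists_nat_pow_near_of_lt_one (norm_unit_pos a) ha (norm_unit_pos q) hq
  have hpos : 0 < ‖(q : F)‖ ^ n := pow_pos (norm_unit_pos q) n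
  have hnorm : ‖((a * (q ^ n)⁻¹ : Fˣ) : F)‖ = ‖(a : F)‖ / ‖(q : F)‖ ^ n := by
    simp [div_eq_mul_inv]
  refine ⟨a * (q ^ n)⁻¹, n, ?_, ?_, by simp⟩
  · rw [hnorm, le_div_iff₀ hpos, ← pow_succ']
    exact hlt.le
  · rwa [hnorm, div_le_one hpos]

variable [ProperSpace F]

theorem exists_norm_le_mul_pow_of_recurrence {R : Type*} [NormedRing R] {f : Fˣ → R}
    (hf : Continuous f) {p : Fˣ} (hp : ‖(p : F)‖ < 1) {D : ℕ} {c : Fin D → R} {δ : ℝ} (hδ : 0 < δ)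
    (hrec : ∀ a : Fˣ, ‖(a : F)‖ ≤ δ → f (a * p ^ D) = ∑ i, c i * f (a * p ^ (i : ℕ))) :
    ∃ S T : ℝ, 0 ≤ S ∧ 0 < T ∧ ∀ (u : Fˣ) (n : ℕ), ‖(p : F)‖ ≤ ‖(u : F)‖ → ‖(u : F)‖ ≤ 1 →
      ‖f (u * p ^ n)‖ ≤ S * T ^ n := by
  have hp0 := norm_unit_pos p
  obtain ⟨n₀, hn₀⟩ := exists_pow_lt_of_lt_one hδ hp
  obtain ⟨S, hS⟩ := (isCompact_setOf_absMax_le (F := F)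
    (‖(p : F)‖ ^ (n₀ + D))⁻¹).exists_bound_of_continuousOn hf.continuousOn
  have hinit : ∀ a : Fˣ, ‖(a : F)‖ ≤ 1 → ‖(p : F)‖ ^ (n₀ + D) ≤ ‖(a : F)‖ → ‖f a‖ ≤ S :=
    fun a ha hpa => hS a <| by
      rw [Set.mem_ofPred_eq, absMax_of_le_one ha]
      gcongr
  have hS0 : 0 ≤ S := (norm_nonneg _).trans
    (hinit 1 (by simp) (by simpa using pow_le_one₀ hp0.le hp.le))
  refine ⟨S, 1 + ∑ i, ‖c i‖, hS0, by positivity, fun u n hpu hu => ?_⟩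
  have hnorm : ∀ m : ℕ, ‖((u * p ^ m : Fˣ) : F)‖ = ‖(u : F)‖ * ‖(p : F)‖ ^ m := fun m => by simp
  have hle : ∀ m : ℕ, ‖((u * p ^ m : Fˣ) : F)‖ ≤ ‖(p : F)‖ ^ m := fun m => by
    rw [hnorm]
    exact mul_le_of_le_one_left (by positivity) hu
  refine norm_le_mul_pow_of_recurrence (b := fun m => f (u * p ^ m)) (n₀ := n₀) hS0
    (fun m hm => hinit _ ((hle m).trans (pow_le_one₀ hp0.le hp.le)) ?_) (fun m hm => ?_) n
  · rw [hnorm]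
    calc ‖(p : F)‖ ^ (n₀ + D) ≤ ‖(p : F)‖ ^ (m + 1) := pow_le_pow_of_le_one hp0.le hp.le hm
      _ = ‖(p : F)‖ * ‖(p : F)‖ ^ m := pow_succ' _ _
      _ ≤ ‖(u : F)‖ * ‖(p : F)‖ ^ m := by gcongr
  · have hsmall := (hle m).trans ((pow_le_pow_of_le_one hp0.le hp.le hm).trans hn₀.le)
    simpa only [mul_assoc, ← pow_add] using hrec _ hsmall

theorem exists_norm_mul_norm_pow_le_of_recurrence {R : Type*} [NormedRing R] {f : Fˣ → R}
    (hf : Continuous f) {p : Fˣ} (hp : ‖(p : F)‖ < 1) {D : ℕ} {c : Fin D → R} {δ : ℝ} (hδ : 0 < δ)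
    (hrec : ∀ a : Fˣ, ‖(a : F)‖ ≤ δ → f (a * p ^ D) = ∑ i, c i * f (a * p ^ (i : ℕ))) :
    ∃ (B : ℕ) (C : ℝ), ∀ a : Fˣ, ‖(a : F)‖ ≤ 1 → ‖f a‖ * ‖(a : F)‖ ^ B ≤ C := by
  have hp0 := norm_unit_pos p
  obtain ⟨S, T, hS, hT, hgeom⟩ := exists_norm_le_mul_pow_of_recurrence hf hp hδ hrec
  obtain ⟨B, hB⟩ := pow_unbounded_of_one_lt T ((one_lt_inv₀ hp0).2 hp)
  have hTB : T * ‖(p : F)‖ ^ B ≤ 1 := by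
    rw [inv_pow, lt_inv_comm₀ hT (by positivity)] at hB
    exact (le_inv_mul_iff₀ hT).1 (by simpa using hB.le)
  refine ⟨B, S, fun a ha => ?_⟩
  obtain ⟨u, n, hpu, hu, rfl⟩ := exists_eq_mul_pow hp ha
  have hle : ‖((u * p ^ n : Fˣ) : F)‖ ≤ ‖(p : F)‖ ^ n := by
    rw [Units.val_mul, Units.val_pow_eq_pow_val, norm_mul, norm_pow]
    exact mul_le_of_le_one_left (by positivity) hu
  calc ‖f (u * p ^ n)‖ * ‖((u * p ^ n : Fˣ) : F)‖ ^ B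
      ≤ S * T ^ n * (‖(p : F)‖ ^ n) ^ B := by
        gcongr
        exact hgeom u n hpu hu
    _ = S * (T * ‖(p : F)‖ ^ B) ^ n := by rw [mul_pow, ← pow_mul, ← pow_mul, mul_comm n B]; ring
    _ ≤ S * 1 ^ n := by gcongr
    _ = S := by rw [one_pow, mul_one]

variable [IsUltrametricDist F] {V : Type*} [AddCommGroup V] [Module ℂ V]
  {π : Representation ℂ (GL (Fin 2) F) V} {ψ : AddChar F Circle} {ℓ : V →ₗ[ℂ] ℂ}

theorem exists_norm_whittaker_diagOne_mul_pow_le (hπ : IsAdmissibleNA π) (hψ : Continuous ψ)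
    (hψ1 : ψ ≠ 1) (hℓ : IsWhittakerFunctional π ψ ℓ) (v : V) :
    ∃ B : ℕ, ∀ M ≥ B, ∃ C : ℝ, ∀ a : Fˣ, ‖ℓ (π (diagOne a) v)‖ * ‖(a : F)‖ ^ M ≤ C := by
  obtain ⟨p, hp⟩ := exists_unit_norm_lt_one F
  obtain ⟨D, c, δ, hδ, hrec⟩ := exists_whittaker_diagOne_recurrence hπ hψ hℓ hp.le v
  obtain ⟨R, hR⟩ := exists_whittaker_diagOne_eq_zero hψ1 hℓ (hπ.smooth v)
  have hcont : Continuous fun a : Fˣ => ℓ (π (diagOne a) v) :=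
    ((isLocallyConstant_apply_of_isOpen (hπ.smooth v)).comp ℓ).continuous.comp continuous_diagOne
  obtain ⟨B, C₀, hC₀⟩ := exists_norm_mul_norm_pow_le_of_recurrence hcont hp hδ hrec
  refine ⟨B, fun M hM => ?_⟩
  obtain ⟨C₁, hC₁⟩ := (isCompact_setOf_absMax_le (F := F) R).exists_bound_of_continuousOn
    (hcont.norm.mul (Units.continuous_val.norm.pow M)).continuousOn
  refine ⟨max (max C₀ C₁) 0, fun a => ?_⟩
  rcases le_total ‖(a : F)‖ 1 with ha | ha
  · refine le_max_of_le_left (le_max_of_le_left (le_trans ?_ (hC₀ a ha)))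
    exact mul_le_mul_of_nonneg_left (pow_le_pow_of_le_one (norm_nonneg _) ha hM) (norm_nonneg _)
  rcases le_total R ‖(a : F)‖ with haR | haR
  · simp [hR a haR]
  · exact le_max_of_le_left (le_max_of_le_right
      ((le_abs_self _).trans (hC₁ a ((absMax_of_one_le ha).trans_le haR))))

theorem hasTorusDecay_of_mem_whittakerNA (hπ : IsAdmissibleNA π) (hψ : Continuous ψ)
    (hψ1 : ψ ≠ 1) {S : Set (GL (Fin 2) F)} (hS : IsCompact S) {W : GL (Fin 2) F → ℂ}
    (hW : W ∈ whittakerNA π ψ) : HasTorusDecay S W := by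
  obtain ⟨ℓ, hℓ, v, rfl⟩ := hW
  have hfinite := finite_image_of_isLocallyConstant
    (isLocallyConstant_apply_of_isOpen (hπ.smooth v)) hS
  choose B hB using exists_norm_whittaker_diagOne_mul_pow_le hπ hψ hψ1 hℓ
  obtain ⟨B₀, hB₀⟩ := (hfinite.image B).bddAbove
  refine ⟨B₀, fun M hM => ?_⟩
  have hBM : ∀ g ∈ S, B (π g v) ≤ M := fun g hg => (hB₀ ⟨_, ⟨g, hg, rfl⟩, rfl⟩).trans hM
  choose! C hC using fun w (hw : B w ≤ M) => hB w M hw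
  obtain ⟨C₀, hC₀⟩ := (hfinite.image C).bddAbove
  refine ⟨C₀, fun g hg a => ?_⟩
  simp only [map_mul, Module.End.mul_apply]
  exact (hC _ (hBM g hg) a).trans (hC₀ ⟨_, ⟨g, hg, rfl⟩, rfl⟩)

end Decay

section FiniteDifferences

open Function
open scoped ContDiff

theorem fwdDiff_iter_map {M G G' : Type*} [AddCommMonoid M] [AddCommGroup G] [AddCommGroup G']
    (L : G →+ G') (f : M → G) (h : M) (n : ℕ) (x : M) :
    (fwdDiff h)^[n] (fun t => L (f t)) x = L ((fwdDiff h)^[n] f x) := by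
  simp only [fwdDiff_iter_eq_sum_shift, map_sum, map_zsmul]

variable {Y : Type*} [NormedAddCommGroup Y] [NormedSpace ℝ Y] {f : ℝ → Y}

theorem hasDerivAt_fwdDiff_iter (hf : Differentiable ℝ f) (n : ℕ) (x : ℝ) :
    HasDerivAt ((fwdDiff 1)^[n] f) ((fwdDiff 1)^[n] (deriv f) x) x := by
  induction n generalizing x with
  | zero => simpa using (hf x).hasDerivAt
  | succ n ih =>
    simp only [iterate_succ_apply', fwdDiff]
    exact ((ih (x + 1)).comp_add_const x 1).sub (ih x)

theorem norm_fwdDiff_iter_le (hf : ContDiff ℝ ∞ f) {n : ℕ} {x C : ℝ}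
    (hC : ∀ r ∈ Set.Icc x (x + n), ‖iteratedDeriv n f r‖ ≤ C) : ‖(fwdDiff 1)^[n] f x‖ ≤ C := by
  induction n generalizing f x with
  | zero => simpa using hC x (by simp)
  | succ n ih =>
    have hdiff : Differentiable ℝ f := hf.differentiable (by simp)
    have hbound : ∀ r ∈ Set.Icc x (x + 1), ‖(fwdDiff 1)^[n] (deriv f) r‖ ≤ C := by
      intro r hr
      refine ih (contDiff_infty_iff_deriv.1 hf).2 fun s hs => ?_
      rw [← iteratedDeriv_succ']
      refine hC s ⟨hr.1.trans hs.1, ?_⟩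
      push_cast
      linarith [hs.2, hr.2]
    have h := (convex_Icc x (x + 1)).norm_image_sub_le_of_norm_hasDerivWithin_le
      (fun r _ => (hasDerivAt_fwdDiff_iter hdiff n r).hasDerivWithinAt) hbound
      (Set.left_mem_Icc.2 (by simp)) (Set.right_mem_Icc.2 (by simp))
    simpa [iterate_succ_apply', fwdDiff] using h

end FiniteDifferences

section IteratedDerivatives

open scoped ContDiff

variable {X Y Z : Type*} [NormedAddCommGroup X] [NormedSpace ℝ X] [NormedAddCommGroup Y]
  [NormedSpace ℝ Y] [NormedAddCommGroup Z] [NormedSpace ℝ Z]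

theorem iteratedFDeriv_comp_const_add_clm {f : X → Y} {Ω : Set X} (hΩ : IsOpen Ω)
    (hf : ContDiffOn ℝ ∞ f Ω) (x : X) (L : Z →L[ℝ] X) {z : Z} (hz : x + L z ∈ Ω) (i : ℕ) :
    iteratedFDeriv ℝ i (fun z => f (x + L z)) z =
      (iteratedFDeriv ℝ i f (x + L z)).compContinuousLinearMap fun _ => L := by
  have hΩx : IsOpen ((x + ·) ⁻¹' Ω) := hΩ.preimage (continuous_const_add x)
  have hfx : ContDiffOn ℝ ∞ (fun y => f (x + y)) ((x + ·) ⁻¹' Ω) :=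
    hf.comp (contDiff_const.add contDiff_id).contDiffOn fun _ hy => hy
  have hΩL : IsOpen (L ⁻¹' ((x + ·) ⁻¹' Ω)) := hΩx.preimage L.continuous
  have h := L.iteratedFDerivWithin_comp_right (x := z) hfx hΩx.uniqueDiffOn hΩL.uniqueDiffOn hz
    (i := i) (by exact_mod_cast le_top)
  rwa [iteratedFDerivWithin_of_isOpen i hΩL hz, iteratedFDerivWithin_of_isOpen i hΩx hz,
    iteratedFDeriv_comp_add_left] at h

theorem norm_iteratedFDeriv_comp_const_add_clm_le {f : X → Y} {Ω : Set X} (hΩ : IsOpen Ω)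
    (hf : ContDiffOn ℝ ∞ f Ω) (x : X) (L : Z →L[ℝ] X) {z : Z} (hz : x + L z ∈ Ω) (i : ℕ) :
    ‖iteratedFDeriv ℝ i (fun z => f (x + L z)) z‖ ≤
      ‖iteratedFDeriv ℝ i f (x + L z)‖ * ‖L‖ ^ i := by
  rw [iteratedFDeriv_comp_const_add_clm hΩ hf x L hz]
  exact (ContinuousMultilinearMap.norm_compContinuousLinearMap_le _ _).trans_eq (by simp)

theorem contDiffOn_iteratedFDeriv {f : X → Y} {Ω : Set X} (hΩ : IsOpen Ω)
    (hf : ContDiffOn ℝ ∞ f Ω) (i : ℕ) : ContDiffOn ℝ ∞ (iteratedFDeriv ℝ i f) Ω := fun _ hx =>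
  ((hf.contDiffAt (hΩ.mem_nhds hx)).iteratedFDeriv_right (m := ∞) (i := i)
    (by exact_mod_cast le_top)).contDiffWithinAt

theorem contDiffOn_iteratedFDeriv_fst {f : X × Z → Y} {Ω : Set (X × Z)} (hΩ : IsOpen Ω)
    (hf : ContDiffOn ℝ ∞ f Ω) (x : X) (i : ℕ) :
    ContDiffOn ℝ ∞ (fun z => iteratedFDeriv ℝ i (fun x => f (x, z)) x) {z | (x, z) ∈ Ω} := by
  have hpair : ∀ (y : X) (z : Z), (0, z) + ContinuousLinearMap.inl ℝ X Z y = (y, z) := by simp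
  have hsmooth : ContDiffOn ℝ ∞ (fun z => ContinuousMultilinearMap.compContinuousLinearMapL
      (fun _ : Fin i => ContinuousLinearMap.inl ℝ X Z) (iteratedFDeriv ℝ i f (x, z)))
      {z | (x, z) ∈ Ω} :=
    (ContinuousLinearMap.contDiff _).comp_contDiffOn <|
      (contDiffOn_iteratedFDeriv hΩ hf i).comp (contDiff_prodMk_right x).contDiffOn fun _ hz => hz
  refine hsmooth.congr fun z hz => ?_
  have h := iteratedFDeriv_comp_const_add_clm hΩ hf (0, z) (ContinuousLinearMap.inl ℝ X Z)
    (z := x) (by rwa [hpair]) i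
  simpa only [hpair, ContinuousMultilinearMap.compContinuousLinearMapL_apply] using h

theorem norm_fwdDiff_iter_line_le {f : X → Y} {Ω : Set X} (hΩ : IsOpen Ω)
    (hf : ContDiffOn ℝ ∞ f Ω) {x w : X} (hline : ∀ r : ℝ, x + r • w ∈ Ω) {n : ℕ} {C : ℝ}
    (hC : ∀ r ∈ Set.Icc (0 : ℝ) n, ‖iteratedFDeriv ℝ n f (x + r • w)‖ ≤ C) :
    ‖(fwdDiff 1)^[n] (fun r : ℝ => f (x + r • w)) 0‖ ≤ C * ‖w‖ ^ n := by
  have hsmooth : ContDiff ℝ ∞ fun r : ℝ => f (x + r • w) :=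
    contDiffOn_univ.1 <| hf.comp (by fun_prop) fun r _ => hline r
  refine norm_fwdDiff_iter_le hsmooth fun r hr => ?_
  rw [zero_add] at hr
  rw [← norm_iteratedFDeriv_eq_norm_iteratedDeriv]
  have h := norm_iteratedFDeriv_comp_const_add_clm_le hΩ hf x
    (ContinuousLinearMap.toSpanSingleton ℝ w) (hline r) n
  rw [ContinuousLinearMap.norm_toSpanSingleton] at h
  exact h.trans (mul_le_mul_of_nonneg_right (hC r hr) (by positivity))

end IteratedDerivatives

section Coordinates

open scoped ContDiff

variable {𝕜 : Type*} [RCLike 𝕜]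

theorem norm_le_one_of_mem_unitaryGL {k : GL (Fin 2) 𝕜} (hk : k ∈ unitaryGL 𝕜) : ‖k.val‖ ≤ 1 :=
  entrywise_sup_norm_bound_of_unitary (Matrix.mem_unitaryGroup_iff'.2 hk)

instance compactSpace_unitaryGL : CompactSpace (unitaryGL 𝕜) := by
  refine isCompact_iff_compactSpace.1 <| (isCompact_setOf_norm_le_GL 1).of_isClosed_subset ?_
    fun k hk => ⟨norm_le_one_of_mem_unitaryGL hk,
      norm_le_one_of_mem_unitaryGL ((unitaryGL 𝕜).inv_mem hk)⟩
  exact isClosed_eq (Units.continuous_val.matrix_conjTranspose.matrix_mul Units.continuous_val)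
    continuous_const

theorem norm_diagOne_inv_mul_mul_le_absMax (a : 𝕜ˣ) (X : Matrix (Fin 2) (Fin 2) 𝕜) :
    ‖((diagOne a)⁻¹).val * X * (diagOne a).val‖ ≤ absMax a * ‖X‖ := by
  have hle : ∀ i j, ‖X i j‖ ≤ ‖X‖ := fun i j => Matrix.norm_entry_le_entrywise_sup_norm X
  have hle' : ∀ i j, ‖X i j‖ ≤ absMax a * ‖X‖ := fun i j =>
    (hle i j).trans (le_mul_of_one_le_left (norm_nonneg _) (one_le_absMax a))
  have habs := (absMax_pos a).le
  rw [diagOne_inv_mul_mul_diagOne, Matrix.norm_le_iff (by positivity)]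
  intro i j
  fin_cases i <;> fin_cases j
  · exact hle' 0 0
  · exact (norm_mul_le _ _).trans
      (mul_le_mul ((norm_inv _).trans_le (le_max_right _ _)) (hle 0 1) (norm_nonneg _) habs)
  · exact (norm_mul_le _ _).trans
      (mul_le_mul (le_max_left _ _) (hle 1 0) (norm_nonneg _) habs)
  · exact hle' 1 1

/-- The matrix coordinates of an invertible matrix, in the normed space on which `orbitMap` is
defined. -/
def coords (g : GL (Fin 2) 𝕜) : Fin 2 → Fin 2 → 𝕜 := Matrix.of.symm g.val

/-- The matrix product in coordinates. -/
def coordMul (x y : Fin 2 → Fin 2 → 𝕜) : Fin 2 → Fin 2 → 𝕜 := fun i j => ∑ l, x i l * y l j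

/-- The conjugation `x ↦ diag(a, 1)⁻¹ x diag(a, 1)` in coordinates. -/
noncomputable def conjDiagOne (a : 𝕜ˣ) : (Fin 2 → Fin 2 → 𝕜) →L[ℝ] (Fin 2 → Fin 2 → 𝕜) :=
  LinearMap.mkContinuous
    { toFun := fun x => Matrix.of.symm (((diagOne a)⁻¹).val * Matrix.of x * (diagOne a).val)
      map_add' := fun x y => by rw [← Matrix.of_add_of, mul_add, add_mul]; rfl
      map_smul' := fun c x => by rw [← Matrix.smul_of, mul_smul_comm, smul_mul_assoc]; rfl }
    (absMax a) (norm_diagOne_inv_mul_mul_le_absMax a)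

theorem continuous_coords : Continuous (coords (𝕜 := 𝕜)) :=
  continuous_pi fun i => continuous_pi fun j => Units.continuous_val.matrix_elem i j

theorem coords_mem_invertibleSet (g : GL (Fin 2) 𝕜) : coords g ∈ invertibleSet 𝕜 := g.isUnit

theorem exists_coords_eq {x : Fin 2 → Fin 2 → 𝕜} (hx : x ∈ invertibleSet 𝕜) : ∃ g, coords g = x :=
  hx

theorem coords_mul (g h : GL (Fin 2) 𝕜) : coords (g * h) = coordMul (coords g) (coords h) := rfl

theorem contDiff_coordMul :
    ContDiff ℝ ∞ fun p : (Fin 2 → Fin 2 → 𝕜) × (Fin 2 → Fin 2 → 𝕜) => coordMul p.1 p.2 := by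
  unfold coordMul
  fun_prop

theorem coords_unip_mul (t : 𝕜) (g : GL (Fin 2) 𝕜) :
    coords (unip t * g) = coords g + t • ![coords g 1, 0] := by
  ext i j
  fin_cases i <;>
    simp [coords, unip, GeneralLinearGroup.upperRightHom, Matrix.vecMul, dotProduct]

theorem norm_conjDiagOne_le (a : 𝕜ˣ) : ‖conjDiagOne a‖ ≤ absMax a :=
  LinearMap.mkContinuous_norm_le _ (absMax_pos a).le _

theorem conjDiagOne_coords (a : 𝕜ˣ) (g : GL (Fin 2) 𝕜) :
    conjDiagOne a (coords g) = coords ((diagOne a)⁻¹ * g * diagOne a) := rfl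

theorem isOpen_invertibleSet : IsOpen (invertibleSet 𝕜) := by
  have hdet : invertibleSet 𝕜 = {x | (Matrix.of x).det ≠ 0} := by
    ext x
    exact (Matrix.isUnit_iff_isUnit_det _).trans isUnit_iff_ne_zero
  rw [hdet]
  exact isOpen_ne_fun (Continuous.matrix_det continuous_id) continuous_const

end Coordinates

section SmoothVectors

open scoped ContDiff

variable {𝕜 : Type*} [RCLike 𝕜] {H : Type*} [NormedAddCommGroup H] [NormedSpace ℂ H]
  {π : GL (Fin 2) 𝕜 →* (H →L[ℂ] H)}

theorem orbitMap_coords (v : H) (g : GL (Fin 2) 𝕜) : orbitMap π v (coords g) = π g v := by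
  have hg : IsUnit (Matrix.of (coords g)) := coords_mem_invertibleSet g
  have hunit : hg.unit = g := Units.ext rfl
  rw [orbitMap, dif_pos hg, hunit]

theorem orbitMap_add (v w : H) : orbitMap π (v + w) = orbitMap π v + orbitMap π w := by
  ext x
  by_cases h : IsUnit (Matrix.of x) <;> simp [orbitMap, h]

theorem eqOn_orbitMap_apply (v : H) (g : GL (Fin 2) 𝕜) :
    Set.EqOn (orbitMap π (π g v)) (fun x => orbitMap π v (coordMul x (coords g)))
      (invertibleSet 𝕜) := by
  intro x hx
  obtain ⟨h, rfl⟩ := exists_coords_eq hx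
  change _ = orbitMap π v (coordMul (coords h) (coords g))
  rw [← coords_mul, orbitMap_coords, orbitMap_coords, map_mul, mul_apply_eq_comp]

theorem eqOn_orbitMap_diagOne (v : H) (a : 𝕜ˣ) :
    Set.EqOn (orbitMap π (π (diagOne a) v))
      (fun x => π (diagOne a) (orbitMap π v (conjDiagOne a x))) (invertibleSet 𝕜) := by
  intro x hx
  obtain ⟨g, rfl⟩ := exists_coords_eq hx
  change _ = π (diagOne a) (orbitMap π v (conjDiagOne a (coords g)))
  rw [conjDiagOne_coords, orbitMap_coords, orbitMap_coords, ← mul_apply_eq_comp,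
    ← mul_apply_eq_comp, ← map_mul, ← map_mul]
  congr 2
  group

theorem contDiffAt_orbitMap (v : smoothVectors π) (g : GL (Fin 2) 𝕜) :
    ContDiffAt ℝ ∞ (orbitMap π (v : H)) (coords g) :=
  ContDiffOn.contDiffAt v.2 (isOpen_invertibleSet.mem_nhds (coords_mem_invertibleSet g))

theorem iteratedFDeriv_eq_of_eqOn_invertibleSet {Y : Type*} [NormedAddCommGroup Y]
    [NormedSpace ℝ Y] {f₁ f₂ : (Fin 2 → Fin 2 → 𝕜) → Y} (h : Set.EqOn f₁ f₂ (invertibleSet 𝕜))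
    (j : ℕ) (g : GL (Fin 2) 𝕜) :
    iteratedFDeriv ℝ j f₁ (coords g) = iteratedFDeriv ℝ j f₂ (coords g) :=
  ((h.eventuallyEq_of_mem (isOpen_invertibleSet.mem_nhds
    (coords_mem_invertibleSet g))).iteratedFDeriv ℝ j).eq_of_nhds

/-- The `j`-th derivative at the identity of the orbit map of a smooth vector, additive in the
vector. Its norm is the `j`-th seminorm of `H^∞`. -/
noncomputable def orbitDeriv (π : GL (Fin 2) 𝕜 →* (H →L[ℂ] H)) (j : ℕ) :
    smoothVectors π →+ ContinuousMultilinearMap ℝ (fun _ : Fin j => Fin 2 → Fin 2 → 𝕜) H :=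
  AddMonoidHom.mk' (fun v => iteratedFDeriv ℝ j (orbitMap π (v : H)) (coords 1)) fun v w => by
    rw [Submodule.coe_add, orbitMap_add]
    exact iteratedFDeriv_add_apply ((contDiffAt_orbitMap v 1).of_le (by exact_mod_cast le_top))
      ((contDiffAt_orbitMap w 1).of_le (by exact_mod_cast le_top))

theorem norm_orbitDeriv_diagOne_le (j : ℕ) (v : smoothVectors π) (a : 𝕜ˣ) :
    ‖orbitDeriv π j (smoothRep π (diagOne a) v)‖ ≤
      ‖π (diagOne a)‖ * (‖orbitDeriv π j v‖ * absMax a ^ j) := by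
  have hone : 0 + conjDiagOne a (coords 1) = coords (1 : GL (Fin 2) 𝕜) := by
    rw [zero_add, conjDiagOne_coords, mul_one, inv_mul_cancel]
  have hsmooth : ContDiffAt ℝ ∞ (fun x => orbitMap π (v : H) (0 + conjDiagOne a x)) (coords 1) := by
    refine ContDiffAt.comp (g := orbitMap π (v : H)) _ ?_ (by fun_prop)
    rw [hone]
    exact contDiffAt_orbitMap v 1
  calc ‖orbitDeriv π j (smoothRep π (diagOne a) v)‖
      = ‖iteratedFDeriv ℝ j ((π (diagOne a)).restrictScalars ℝ ∘
          fun x => orbitMap π (v : H) (0 + conjDiagOne a x)) (coords 1)‖ :=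
        congrArg norm <| iteratedFDeriv_eq_of_eqOn_invertibleSet
          (by simp only [zero_add]; exact eqOn_orbitMap_diagOne (v : H) a) j 1
    _ ≤ ‖π (diagOne a)‖ *
          ‖iteratedFDeriv ℝ j (fun x => orbitMap π (v : H) (0 + conjDiagOne a x)) (coords 1)‖ :=
        ContinuousLinearMap.norm_iteratedFDeriv_comp_left _ hsmooth (by exact_mod_cast le_top)
    _ ≤ ‖π (diagOne a)‖ * (‖iteratedFDeriv ℝ j (orbitMap π (v : H)) (coords 1)‖ *
          ‖conjDiagOne a‖ ^ j) := by
        gcongr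
        have h := norm_iteratedFDeriv_comp_const_add_clm_le isOpen_invertibleSet v.2 0
          (conjDiagOne a) (z := coords 1) (by rw [hone]; exact coords_mem_invertibleSet 1) j
        rwa [hone] at h
    _ ≤ ‖π (diagOne a)‖ * (‖orbitDeriv π j v‖ * absMax a ^ j) := by
        gcongr
        · exact le_rfl
        · exact norm_conjDiagOne_le a

theorem exists_contDiffOn_eq_orbitDeriv (j : ℕ) (v : smoothVectors π) :
    ∃ Φ : (Fin 2 → Fin 2 → 𝕜) → ContinuousMultilinearMap ℝ (fun _ : Fin j => Fin 2 → Fin 2 → 𝕜) H,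
      ContDiffOn ℝ ∞ Φ (invertibleSet 𝕜) ∧
        ∀ g, orbitDeriv π j (smoothRep π g v) = Φ (coords g) := by
  set Ω : Set ((Fin 2 → Fin 2 → 𝕜) × (Fin 2 → Fin 2 → 𝕜)) :=
    (fun p => coordMul p.1 p.2) ⁻¹' invertibleSet 𝕜
  have hΩ : IsOpen Ω := isOpen_invertibleSet.preimage contDiff_coordMul.continuous
  have hsmooth : ContDiffOn ℝ ∞ (fun p => orbitMap π (v : H) (coordMul p.1 p.2)) Ω :=
    ContDiffOn.comp v.2 contDiff_coordMul.contDiffOn fun _ hp => hp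
  refine ⟨_, (contDiffOn_iteratedFDeriv_fst hΩ hsmooth (coords 1) j).mono fun x hx => ?_,
    fun g => iteratedFDeriv_eq_of_eqOn_invertibleSet (eqOn_orbitMap_apply (v : H) g) j 1⟩
  obtain ⟨g, rfl⟩ := exists_coords_eq hx
  change coordMul (coords 1) (coords g) ∈ invertibleSet 𝕜
  rw [← coords_mul]
  exact coords_mem_invertibleSet _

theorem continuous_orbitDeriv (j : ℕ) (v : smoothVectors π) :
    Continuous fun g => orbitDeriv π j (smoothRep π g v) := by
  obtain ⟨Φ, hΦ, hval⟩ := exists_contDiffOn_eq_orbitDeriv j v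
  simp only [hval]
  exact hΦ.continuousOn.comp_continuous continuous_coords coords_mem_invertibleSet

theorem norm_vecCons_coords_le (k : GL (Fin 2) 𝕜) :
    ‖(![coords k 1, 0] : Fin 2 → Fin 2 → 𝕜)‖ ≤ ‖coords k‖ :=
  (pi_norm_le_iff_of_nonneg (norm_nonneg _)).2 fun i => by
    fin_cases i
    · exact norm_le_pi_norm (coords k) 1
    · simp

theorem exists_norm_orbitDeriv_fwdDiff_le (j M : ℕ) (v : smoothVectors π)
    {S : Set (GL (Fin 2) 𝕜)} (hS : IsCompact S) (R : ℝ) :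
    ∃ C : ℝ, 0 ≤ C ∧ ∀ k ∈ S, ∀ h : 𝕜, ‖h‖ ≤ R →
      ‖orbitDeriv π j ((fwdDiff h)^[M] (fun t => smoothRep π (unip t * k) v) 0)‖ ≤
        C * ‖h‖ ^ M := by
  obtain ⟨Φ, hΦ, hval⟩ := exists_contDiffOn_eq_orbitDeriv j v
  set line : 𝕜 × GL (Fin 2) 𝕜 → Fin 2 → Fin 2 → 𝕜 := fun p => coords (unip p.1 * p.2)
  have hline : Continuous line := by
    have := continuous_coords (𝕜 := 𝕜)
    simp only [line, coords_unip_mul]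
    fun_prop
  have hlineS : IsCompact (Metric.closedBall (0 : 𝕜) (M * R) ×ˢ S) :=
    (isCompact_closedBall _ _).prod hS
  obtain ⟨C, hC⟩ := hlineS.exists_bound_of_continuousOn
    (((contDiffOn_iteratedFDeriv isOpen_invertibleSet hΦ M).continuousOn.comp_continuous hline
      fun _ => coords_mem_invertibleSet _).continuousOn)
  obtain ⟨D, hD⟩ := hS.exists_bound_of_continuousOn continuous_coords.continuousOn
  refine ⟨|C| * |D| ^ M, by positivity, fun k hk h hh => ?_⟩
  set w : Fin 2 → Fin 2 → 𝕜 := h • ![coords k 1, 0]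
  have hseg : ∀ r : ℝ, coords k + r • w = line (r • h, k) := fun r => by
    simp only [line, w, coords_unip_mul, smul_assoc]
  have hw : ‖w‖ ≤ |D| * ‖h‖ := by
    rw [norm_smul, mul_comm]
    gcongr
    exact (norm_vecCons_coords_le k).trans ((hD k hk).trans (le_abs_self D))
  have heq : orbitDeriv π j ((fwdDiff h)^[M] (fun t => smoothRep π (unip t * k) v) 0) =
      (fwdDiff 1)^[M] (fun r : ℝ => Φ (coords k + r • w)) 0 := by
    rw [← fwdDiff_iter_map]
    simp only [hval, hseg, line, fwdDiff_iter_eq_sum_shift, zero_add, nsmul_eq_mul, mul_one,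
      RCLike.real_smul_eq_coe_mul, RCLike.ofReal_natCast]
  rw [heq, mul_assoc, ← mul_pow]
  refine (norm_fwdDiff_iter_line_le isOpen_invertibleSet hΦ
    (fun r => hseg r ▸ coords_mem_invertibleSet _) (C := |C|) fun r hr => ?_).trans (by gcongr)
  rw [hseg]
  refine (hC (r • h, k) ⟨?_, hk⟩).trans (le_abs_self C)
  rw [mem_closedBall_zero_iff, norm_smul, Real.norm_of_nonneg hr.1]
  exact mul_le_mul hr.2 hh (norm_nonneg _) (Nat.cast_nonneg _)

end SmoothVectors

theorem hasTorusDecay_of_norm_sub_one_pow_mul_le {F : Type*} [NontriviallyNormedField F]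
    {ψ : AddChar F Circle} {x₀ : F} (hx₀ : ψ x₀ ≠ 1) {S : Set (GL (Fin 2) F)}
    {W : GL (Fin 2) F → ℂ} {A : ℕ}
    (hW : ∀ M : ℕ, ∃ E : ℝ, 0 ≤ E ∧ ∀ k ∈ S, ∀ (a : Fˣ) (h : F), ‖h‖ ≤ ‖x₀‖ →
      ‖((ψ (a * h) : ℂ) - 1) ^ M * W (diagOne a * k)‖ ≤ E * absMax a ^ A * ‖h‖ ^ M) :
    HasTorusDecay S W := by
  set η : ℝ := ‖(ψ x₀ : ℂ) - 1‖
  have hη : 0 < η := norm_pos_iff.2 <| sub_ne_zero.2 fun h => hx₀ (Circle.ext h)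
  refine ⟨A, fun M hM => ?_⟩
  obtain ⟨E₀, hE₀, hsmall⟩ := hW 0
  obtain ⟨E, -, hlarge⟩ := hW (A + M)
  refine ⟨max E₀ (E * ‖x₀‖ ^ (A + M) / η ^ (A + M)), fun k hk a => ?_⟩
  have ha := norm_unit_pos a
  rcases le_total ‖(a : F)‖ 1 with ha1 | ha1
  · refine le_max_of_le_left ?_
    have h := hsmall k hk a 0 (by simp)
    rw [pow_zero, one_mul, pow_zero, mul_one, absMax_of_le_one ha1] at h
    calc ‖W (diagOne a * k)‖ * ‖(a : F)‖ ^ M ≤ E₀ * ‖(a : F)‖⁻¹ ^ A * ‖(a : F)‖ ^ A :=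
          mul_le_mul h (pow_le_pow_of_le_one ha.le ha1 hM) (by positivity) (by positivity)
      _ = E₀ := by rw [inv_pow, inv_mul_cancel_right₀ (pow_pos ha A).ne']
  · refine le_max_of_le_right ?_
    -- The increment `x₀ / a` keeps `ψ (a * h) - 1` away from zero while `‖h‖ ^ M` gains `‖a‖ ^ M`.
    have h := hlarge k hk a (x₀ / a) (by
      rw [norm_div]
      exact div_le_self (norm_nonneg _) ha1)
    rw [mul_div_cancel₀ _ a.ne_zero, norm_mul, norm_pow, norm_div, absMax_of_one_le ha1] at h
    rw [le_div_iff₀ (pow_pos hη _)]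
    calc ‖W (diagOne a * k)‖ * ‖(a : F)‖ ^ M * η ^ (A + M)
        = η ^ (A + M) * ‖W (diagOne a * k)‖ * ‖(a : F)‖ ^ M := by ring
      _ ≤ E * ‖(a : F)‖ ^ A * (‖x₀‖ / ‖(a : F)‖) ^ (A + M) * ‖(a : F)‖ ^ M := by gcongr
      _ = E * ‖x₀‖ ^ (A + M) := by
          rw [div_pow, pow_add ‖(a : F)‖]
          field_simp

section ArchimedeanWhittaker

variable {𝕜 : Type*} [RCLike 𝕜] {H : Type*} [NormedAddCommGroup H] [NormedSpace ℂ H]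
  {π : GL (Fin 2) 𝕜 →* (H →L[ℂ] H)} {ψ : AddChar 𝕜 Circle} {ℓ : smoothVectors π →ₗ[ℂ] ℂ}

theorem exists_opNorm_diagOne_le [CompleteSpace H] (hπ : ∀ v : H, Continuous fun g => π g v) :
    ∃ (C : ℝ) (A : ℕ), 0 ≤ C ∧ ∀ a : 𝕜ˣ, ‖π (diagOne a)‖ ≤ C * absMax a ^ A := by
  refine submultiplicative_le_absMax_pow (fun a => norm_nonneg _) (fun a b => ?_) fun R => ?_
  · rw [diagOne_mul, map_mul]
    exact norm_mul_le _ _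
  · obtain ⟨C, hC⟩ := banach_steinhaus (g := fun a : {a : 𝕜ˣ | absMax a ≤ R} => π (diagOne a.1))
      fun v => by
        obtain ⟨C, hC⟩ := (isCompact_setOf_absMax_le R).exists_bound_of_continuousOn
          ((hπ v).comp continuous_diagOne).continuousOn
        exact ⟨C, fun a => hC a a.2⟩
    exact ⟨C, fun a ha => hC ⟨a, ha⟩⟩

theorem IsSmoothContinuous.exists_norm_le (hℓ : IsSmoothContinuous π ℓ) :
    ∃ (N : ℕ) (C : ℝ), 0 ≤ C ∧
      ∀ v, ‖ℓ v‖ ≤ C * ∑ j ∈ Finset.range (N + 1), ‖orbitDeriv π j v‖ := by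
  obtain ⟨N, C, h⟩ := hℓ
  refine ⟨N, |C|, abs_nonneg C, fun v => (h v).trans ?_⟩
  exact mul_le_mul_of_nonneg_right (le_abs_self C) (Finset.sum_nonneg fun _ _ => norm_nonneg _)

theorem IsSmoothContinuous.exists_norm_diagOne_le [CompleteSpace H]
    (hℓ : IsSmoothContinuous π ℓ) (hπ : ∀ v : H, Continuous fun g => π g v) :
    ∃ (N A : ℕ) (C : ℝ), 0 ≤ C ∧ ∀ (a : 𝕜ˣ) v, ‖ℓ (smoothRep π (diagOne a) v)‖ ≤
      C * absMax a ^ A * ∑ j ∈ Finset.range (N + 1), ‖orbitDeriv π j v‖ := by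
  obtain ⟨N, C, hC, hℓ⟩ := hℓ.exists_norm_le
  obtain ⟨D, A, hD, hπ⟩ := exists_opNorm_diagOne_le hπ
  refine ⟨N, A + N, C * D, mul_nonneg hC hD, fun a v => ?_⟩
  have hterm : ∀ j ∈ Finset.range (N + 1), ‖orbitDeriv π j (smoothRep π (diagOne a) v)‖ ≤
      D * absMax a ^ (A + N) * ‖orbitDeriv π j v‖ := fun j hj => by
    have hone := one_le_absMax a
    have := absMax_pos a
    have hjN : j ≤ N := Nat.lt_succ_iff.1 (Finset.mem_range.1 hj)
    calc ‖orbitDeriv π j (smoothRep π (diagOne a) v)‖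
        ≤ ‖π (diagOne a)‖ * (‖orbitDeriv π j v‖ * absMax a ^ j) := norm_orbitDeriv_diagOne_le j v a
      _ ≤ D * absMax a ^ A * (‖orbitDeriv π j v‖ * absMax a ^ N) := by
          gcongr
          exact hπ a
      _ = D * absMax a ^ (A + N) * ‖orbitDeriv π j v‖ := by ring
  calc ‖ℓ (smoothRep π (diagOne a) v)‖
      ≤ C * ∑ j ∈ Finset.range (N + 1), ‖orbitDeriv π j (smoothRep π (diagOne a) v)‖ := hℓ _
    _ ≤ C * ∑ j ∈ Finset.range (N + 1), D * absMax a ^ (A + N) * ‖orbitDeriv π j v‖ := by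
        gcongr with j hj
        exact hterm j hj
    _ = C * D * absMax a ^ (A + N) * ∑ j ∈ Finset.range (N + 1), ‖orbitDeriv π j v‖ := by
        rw [← Finset.mul_sum]
        ring

theorem continuous_of_mem_whittakerArch {W : GL (Fin 2) 𝕜 → ℂ} (hW : W ∈ whittakerArch π ψ) :
    Continuous W := by
  obtain ⟨ℓ, hℓ, -, v, rfl⟩ := hW
  obtain ⟨N, C, -, h⟩ := hℓ.exists_norm_le
  refine continuous_iff_continuousAt.2 fun g₀ => tendsto_iff_norm_sub_tendsto_zero.2 ?_
  refine squeeze_zero (g := fun g => C * ∑ j ∈ Finset.range (N + 1),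
    ‖orbitDeriv π j (smoothRep π g v) - orbitDeriv π j (smoothRep π g₀ v)‖)
    (fun _ => norm_nonneg _) (fun g => ?_) ?_
  · simpa only [map_sub] using h (smoothRep π g v - smoothRep π g₀ v)
  · have hcont : Continuous fun g => C * ∑ j ∈ Finset.range (N + 1),
        ‖orbitDeriv π j (smoothRep π g v) - orbitDeriv π j (smoothRep π g₀ v)‖ :=
      continuous_const.mul <| continuous_finsetSum _ fun j _ =>
        ((continuous_orbitDeriv j v).sub continuous_const).norm
    simpa only [sub_self, norm_zero, Finset.sum_const_zero, mul_zero] using hcont.tendsto g₀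

theorem IsWhittakerFunctional.apply_diagOne_fwdDiff
    (hℓ : IsWhittakerFunctional (smoothRep π) ψ ℓ) (v : smoothVectors π) (a : 𝕜ˣ)
    (k : GL (Fin 2) 𝕜) (h : 𝕜) (M : ℕ) :
    ℓ (smoothRep π (diagOne a) ((fwdDiff h)^[M] (fun t => smoothRep π (unip t * k) v) 0)) =
      ((ψ (a * h) : ℂ) - 1) ^ M * ℓ (smoothRep π (diagOne a * k) v) := by
  let φ : AddChar 𝕜 ℂ :=
    (Circle.coeHom.compAddChar ψ).compAddMonoidHom (AddMonoidHom.mulLeft (a : 𝕜))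
  have hval : ∀ t : 𝕜, ℓ (smoothRep π (diagOne a) (smoothRep π (unip t * k) v)) =
      ℓ (smoothRep π (diagOne a * k) v) • φ t := fun t => by
    rw [map_mul, Module.End.mul_apply, hℓ.apply_diagOne_unip, map_mul (smoothRep π) (diagOne a),
      Module.End.mul_apply, smul_eq_mul, mul_comm]
    rfl
  calc ℓ (smoothRep π (diagOne a) ((fwdDiff h)^[M] (fun t => smoothRep π (unip t * k) v) 0))
      = (fwdDiff h)^[M] (ℓ (smoothRep π (diagOne a * k) v) • (φ : 𝕜 → ℂ)) 0 := by
        rw [show ℓ (smoothRep π (diagOne a * k) v) • (φ : 𝕜 → ℂ) = _ from (funext hval).symm]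
        exact (fwdDiff_iter_map (ℓ ∘ₗ smoothRep π (diagOne a)).toAddMonoidHom _ h M 0).symm
    _ = ((ψ (a * h) : ℂ) - 1) ^ M * ℓ (smoothRep π (diagOne a * k) v) := by
        rw [fwdDiff_iter_const_smul, Pi.smul_apply, fwdDiff_addChar_eq, AddChar.map_zero_eq_one,
          mul_one, smul_eq_mul, mul_comm]
        rfl

theorem hasTorusDecay_of_mem_whittakerArch [CompleteSpace H]
    (hπ : ∀ v : H, Continuous fun g => π g v) (hψ : ψ ≠ 1) {S : Set (GL (Fin 2) 𝕜)}
    (hS : IsCompact S) {W : GL (Fin 2) 𝕜 → ℂ} (hW : W ∈ whittakerArch π ψ) :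
    HasTorusDecay S W := by
  obtain ⟨ℓ, hℓcont, hℓ, v, rfl⟩ := hW
  obtain ⟨x₀, hx₀⟩ := AddChar.ne_one_iff.1 hψ
  obtain ⟨N, A, C, hC, hbound⟩ := hℓcont.exists_norm_diagOne_le hπ
  refine hasTorusDecay_of_norm_sub_one_pow_mul_le hx₀ (A := A) fun M => ?_
  choose E hE hdiff using fun j => exists_norm_orbitDeriv_fwdDiff_le j M v hS ‖x₀‖
  refine ⟨C * ∑ j ∈ Finset.range (N + 1), E j,
    mul_nonneg hC (Finset.sum_nonneg fun j _ => hE j), fun k hk a h hh => ?_⟩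
  have hpos := absMax_pos a
  rw [← hℓ.apply_diagOne_fwdDiff]
  calc ‖ℓ (smoothRep π (diagOne a) ((fwdDiff h)^[M] (fun t => smoothRep π (unip t * k) v) 0))‖
      ≤ C * absMax a ^ A * ∑ j ∈ Finset.range (N + 1), E j * ‖h‖ ^ M := by
        refine (hbound a _).trans ?_
        gcongr with j
        exact hdiff j k hk h hh
    _ = C * (∑ j ∈ Finset.range (N + 1), E j) * absMax a ^ A * ‖h‖ ^ M := by
        rw [← Finset.sum_mul]
        ring

end ArchimedeanWhittaker

section SchwartzFunctions

theorem IsSchwartzBruhatNA.isRapidlyDecreasing {F : Type*} [NontriviallyNormedField F]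
    {f : Matrix (Fin 2) (Fin 2) F × Matrix (Fin 2) (Fin 2) F → ℂ} (hf : IsSchwartzBruhatNA f) :
    IsRapidlyDecreasing f :=
  isRapidlyDecreasing_of_hasCompactSupport hf.2 hf.1.continuous

variable {𝕜 : Type*} [RCLike 𝕜] {f : Matrix (Fin 2) (Fin 2) 𝕜 × Matrix (Fin 2) (Fin 2) 𝕜 → ℂ}

theorem IsSchwartzArch.continuous (hf : IsSchwartzArch f) : Continuous f := by
  obtain ⟨φ, hφ⟩ := hf
  rw [show f = φ from funext fun p => hφ p.1 p.2]
  exact φ.continuous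

theorem IsSchwartzArch.isRapidlyDecreasing (hf : IsSchwartzArch f) : IsRapidlyDecreasing f := by
  obtain ⟨φ, hφ⟩ := hf
  rw [show f = φ from funext fun p => hφ p.1 p.2]
  exact isRapidlyDecreasing_schwartzMap φ

end SchwartzFunctions

end ZetaTwo

theorem mainTheorem9_general :
    (∀ (F : Type*) [NontriviallyNormedField F] [IsUltrametricDist F] [LocallyCompactSpace F]
      [MeasurableSpace F] [BorelSpace F] (K : Subgroup (GL (Fin 2) F)) [CompactSpace K]
      [MeasurableSpace K] [BorelSpace K] (dx : Measure F) [dx.IsAddHaarMeasure]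
      (dt : Measure Fˣ) [dt.IsHaarMeasure] (dk : Measure K) [IsFiniteMeasure dk]
      (ψ : AddChar F Circle) (_ : Continuous ψ) (_ : ∃ x, ψ x ≠ 1)
      (V₁ V₂ : Type*) [AddCommGroup V₁] [Module ℂ V₁] [AddCommGroup V₂] [Module ℂ V₂]
      (π₁ : Representation ℂ (GL (Fin 2) F) V₁) (π₂ : Representation ℂ (GL (Fin 2) F) V₂)
      (_ : ZetaTwo.IsAdmissibleNA π₁) (_ : ZetaTwo.IsAdmissibleNA π₂) (ω μ : Fˣ →ₜ* ℂˣ),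
      ∀ W₁ ∈ ZetaTwo.whittakerNA π₁ ψ, ∀ W₂ ∈ ZetaTwo.whittakerNA π₂ ψ,
        ∃ c : ℝ, ∀ f, ZetaTwo.IsSchwartzBruhatNA f →
          ∀ s₁ s₂ : ℂ, c < s₁.re → c < s₂.re →
            ZetaTwo.ZetaConvergesAbsolutely dx dt dk ψ ω μ W₁ W₂ f s₁ s₂) ∧
    (∀ (𝕜 : Type*) [RCLike 𝕜] (K : Subgroup (GL (Fin 2) 𝕜)) [CompactSpace K]
      [MeasurableSpace K] [BorelSpace K] (dx : Measure 𝕜) [dx.IsAddHaarMeasure]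
      (dt : Measure 𝕜ˣ) [dt.IsHaarMeasure] (dk : Measure K) [IsFiniteMeasure dk]
      (ψ : AddChar 𝕜 Circle) (_ : Continuous ψ) (_ : ∃ x, ψ x ≠ 1)
      (H₁ H₂ : Type*) [NormedAddCommGroup H₁] [NormedSpace ℂ H₁] [CompleteSpace H₁]
      [NormedAddCommGroup H₂] [NormedSpace ℂ H₂] [CompleteSpace H₂]
      (π₁ : GL (Fin 2) 𝕜 →* (H₁ →L[ℂ] H₁)) (π₂ : GL (Fin 2) 𝕜 →* (H₂ →L[ℂ] H₂))
      (_ : ∀ v, Continuous fun g => π₁ g v) (_ : ∀ v, Continuous fun g => π₂ g v)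
      (ω μ : 𝕜ˣ →ₜ* ℂˣ),
      ∀ W₁ ∈ ZetaTwo.whittakerArch π₁ ψ, ∀ W₂ ∈ ZetaTwo.whittakerArch π₂ ψ,
        ∃ c : ℝ, ∀ f, ZetaTwo.IsSchwartzArch f →
          ∀ s₁ s₂ : ℂ, c < s₁.re → c < s₂.re →
            ZetaTwo.ZetaConvergesAbsolutely dx dt dk ψ ω μ W₁ W₂ f s₁ s₂) := by
  constructor
  · intro F _ _ _ _ _ K _ _ _ dx _ dt _ dk _ ψ hψ hψ1 V₁ V₂ _ _ _ _ π₁ π₂ h₁ h₂ ω μ W₁ hW₁ W₂ hW₂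
    have : ProperSpace F := .of_locallyCompactSpace F
    have hK : IsCompact (K : Set (GL (Fin 2) F)) := isCompact_iff_compactSpace.2 inferInstance
    have hdecay₁ := ZetaTwo.hasTorusDecay_of_mem_whittakerNA h₁ hψ (AddChar.ne_one_iff.2 hψ1) hK hW₁
    have hdecay₂ := ZetaTwo.hasTorusDecay_of_mem_whittakerNA h₂ hψ (AddChar.ne_one_iff.2 hψ1) hK hW₂
    obtain ⟨c, hc⟩ := ZetaTwo.exists_zetaConvergesAbsolutely dx dt dk hψ ω μ
      (ZetaTwo.continuous_of_mem_whittakerNA h₁ hW₁) (ZetaTwo.continuous_of_mem_whittakerNA h₂ hW₂)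
      hdecay₁ hdecay₂
    exact ⟨c, fun f hf => hc f hf.1.continuous hf.isRapidlyDecreasing⟩
  · intro 𝕜 _ K _ _ _ dx _ dt _ dk _ ψ hψ hψ1 H₁ H₂ _ _ _ _ _ _ π₁ π₂ h₁ h₂ ω μ W₁ hW₁ W₂ hW₂
    have hK : IsCompact (K : Set (GL (Fin 2) 𝕜)) := isCompact_iff_compactSpace.2 inferInstance
    have hdecay₁ := ZetaTwo.hasTorusDecay_of_mem_whittakerArch h₁ (AddChar.ne_one_iff.2 hψ1) hK hW₁
    have hdecay₂ := ZetaTwo.hasTorusDecay_of_mem_whittakerArch h₂ (AddChar.ne_one_iff.2 hψ1) hK hW₂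
    obtain ⟨c, hc⟩ := ZetaTwo.exists_zetaConvergesAbsolutely dx dt dk hψ ω μ
      (ZetaTwo.continuous_of_mem_whittakerArch hW₁) (ZetaTwo.continuous_of_mem_whittakerArch hW₂)
      hdecay₁ hdecay₂
    exact ⟨c, fun f hf => hc f hf.continuous hf.isRapidlyDecreasing⟩

theorem mainTheorem9 :
    -- non-archimedean places
    (∀ (F : Type*) [NontriviallyNormedField F] [IsUltrametricDist F] [LocallyCompactSpace F]
      [CharZero F] [MeasurableSpace F] [BorelSpace F]
      [MeasurableSpace (ZetaTwo.integralGL F)] [BorelSpace (ZetaTwo.integralGL F)]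
      (dx : Measure F) [dx.IsAddHaarMeasure] (dt : Measure Fˣ) [dt.IsHaarMeasure]
      (dk : Measure (ZetaTwo.integralGL F)) [dk.IsHaarMeasure]
      (ψ : AddChar F Circle) (_ : Continuous ψ) (_ : ∃ x, ψ x ≠ 1)
      (V₁ V₂ : Type*) [AddCommGroup V₁] [Module ℂ V₁] [AddCommGroup V₂] [Module ℂ V₂]
      (π₁ : Representation ℂ (GL (Fin 2) F) V₁) (π₂ : Representation ℂ (GL (Fin 2) F) V₂)
      (_ : π₁.IsIrreducible) (_ : π₂.IsIrreducible)
      (_ : ZetaTwo.IsAdmissibleNA π₁) (_ : ZetaTwo.IsAdmissibleNA π₂)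
      (ω₁ ω₂ : Fˣ →ₜ* ℂˣ)
      (_ : ZetaTwo.IsCentralCharacter π₁ ω₁) (_ : ZetaTwo.IsCentralCharacter π₂ ω₂)
      (_ : ∀ z, ω₁ z * ω₂ z = 1) (μ : Fˣ →ₜ* ℂˣ),
      ∀ W₁ ∈ ZetaTwo.whittakerNA π₁ ψ, ∀ W₂ ∈ ZetaTwo.whittakerNA π₂ ψ,
        ∃ c : ℝ, ∀ f, ZetaTwo.IsSchwartzBruhatNA f →
          ∀ s₁ s₂ : ℂ, c < s₁.re → c < s₂.re →
            ZetaTwo.ZetaConvergesAbsolutely dx dt dk ψ ω₂ μ W₁ W₂ f s₁ s₂) ∧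
    -- archimedean places
    (∀ (𝕜 : Type*) [RCLike 𝕜]
      [MeasurableSpace (ZetaTwo.unitaryGL 𝕜)] [BorelSpace (ZetaTwo.unitaryGL 𝕜)]
      (dx : Measure 𝕜) [dx.IsAddHaarMeasure] (dt : Measure 𝕜ˣ) [dt.IsHaarMeasure]
      (dk : Measure (ZetaTwo.unitaryGL 𝕜)) [dk.IsHaarMeasure]
      (ψ : AddChar 𝕜 Circle) (_ : Continuous ψ) (_ : ∃ x, ψ x ≠ 1)
      (H₁ H₂ : Type*) [NormedAddCommGroup H₁] [NormedSpace ℂ H₁] [CompleteSpace H₁]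
      [NormedAddCommGroup H₂] [NormedSpace ℂ H₂] [CompleteSpace H₂]
      (π₁ : GL (Fin 2) 𝕜 →* (H₁ →L[ℂ] H₁)) (π₂ : GL (Fin 2) 𝕜 →* (H₂ →L[ℂ] H₂))
      (_ : ZetaTwo.IsIrreducibleAdmissibleArch π₁) (_ : ZetaTwo.IsIrreducibleAdmissibleArch π₂)
      (ω₁ ω₂ : 𝕜ˣ →ₜ* ℂˣ)
      (_ : ZetaTwo.IsCentralCharacterArch π₁ ω₁) (_ : ZetaTwo.IsCentralCharacterArch π₂ ω₂)
      (_ : ∀ z, ω₁ z * ω₂ z = 1) (μ : 𝕜ˣ →ₜ* ℂˣ),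
      ∀ W₁ ∈ ZetaTwo.whittakerArch π₁ ψ, ∀ W₂ ∈ ZetaTwo.whittakerArch π₂ ψ,
        ∃ c : ℝ, ∀ f, ZetaTwo.IsSchwartzArch f →
          ∀ s₁ s₂ : ℂ, c < s₁.re → c < s₂.re →
            ZetaTwo.ZetaConvergesAbsolutely dx dt dk ψ ω₂ μ W₁ W₂ f s₁ s₂) :=
  mainTheorem9_general.imp
    (fun nonarch F _ _ _ _ _ _ _ _ dx _ dt _ dk _ ψ hψ hψ1 V₁ V₂ _ _ _ _ π₁ π₂ _ _ h₁ h₂ _ ω₂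
        _ _ _ μ =>
      have : ProperSpace F := .of_locallyCompactSpace F
      nonarch F _ dx dt dk ψ hψ hψ1 V₁ V₂ π₁ π₂ h₁ h₂ ω₂ μ)
    fun arch 𝕜 _ _ _ dx _ dt _ dk _ ψ hψ hψ1 H₁ H₂ _ _ _ _ _ _ π₁ π₂ h₁ h₂ _ ω₂ _ _ _ μ =>
      arch 𝕜 _ dx dt dk ψ hψ hψ1 H₁ H₂ π₁ π₂ h₁.continuous h₂.continuous ω₂ μ
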